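/- Conventions. A graphing $\mathcal G=(V,\mathcal B,E,\mu)$ is a standard Borel space $(V,\mathcal B)$ with a probability measure $\mu$ and a Borel symmetric irreflexive relation $E\subseteq V\times V$ for which there are finitely many measure-preserving invertible Borel bijections $\phi_i:A_i\to B_i$ ($i\in[k]$, $A_i,B_i\in\mathcal B$) such that $xy\in E$ if and only if $x\neq y$ and, for some $i$, $\phi_i(x)=y$ or $\phi_i(y)=x$. Distances are graph distances ($\infty$ between different components) and $N_1(X)$ is the set of vertices at distance at most $1$ from $X$. A set $X\subseteq V$ is $r$-sparse if every two distinct elements of $X$ are at distance greater than $r$, and $r$-dense if every vertex is at distance at most $r$ from $X$. For a given integer $d$, a stump is a finite set $A$ of at least two vertices, lying inside one infinite component, such that at most $d-1$ edges join $A$ to its complement and all vertices of $A$ have degree $d$ except at most one, of degree $d+1$. Let $K\subseteq V$ and let $M\subseteq E$ be a matching; $V(M)$ is the set of vertices covered by $M$. For $x\in K$, the star of $x$ is $D(x)=\{y\in N_1(\{x\}):\deg(y)=d\}$; it is complete if $D(x)\subseteq V(M)$. The truncated star $D'_M(x)$ is $D(x)\setminus V(M)$ with one vertex removed if this set is non-empty;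 the removed vertex is arbitrary, but is chosen by a fixed Borel function of $x$ (for example, the vertex with the largest label in a fixed Borel labeling of $V$ by $\{1,\dots,m\}$ in which every two distinct vertices with the same label are at distance greater than $2$). The set of unhappy vertices is $$U_M=\bigl\{x\in V\setminus N_1(K):\deg(x)\ge d,\ x\notin V(M)\bigr\}\ \cup\ \bigcup_{x\in K}D'_M(x).$$ An alternating path is a path that starts in a vertex outside $V(M)$ and whose edges are alternately outside and inside $M$. An augmenting path is an alternating path that starts in a vertex of $U_M$ and that either has odd length and ends in a vertex outside $V(M)$, or has even length and ends in a vertex of degree less than $d$ or in a vertex of a complete star $D(x)$ with $x\in K$. The length of a path is its number of edges. Theorem. For all integers $d\ge 2$ and $r'\ge 0$ there are constants $c=c(d,r')>0$ and $r_2=r_2(d,r')\in\mathbb N$ such that the following holds. Let $\mathcal G=(V,\mathcal B,E,\mu)$ be a graphing with maximum degree at most $d+1$, all of whose connectivity components are infinite, and suppose that the set $J$ of all vertices of degree $d+1$ is $r_2$-sparse. Let $K\subseteq V$ be an $r'$-dense Borel set, let $n_0\in\mathbb N$, and let $M\subseteq E$ be a Borel matching that admits no augmenting path of length at most $n_0$.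 If every vertex of $U_M$ is at distance greater than $r_2/4$ from $J$, and $\mathcal G$ has no odd cycles or has no stumps, then $U_M$ is a Borel set and $$\mu(U_M)\le\frac{(1+c)^{-n_0}}{c}.$$ -/

import Mathlib

open MeasureTheory

universe u

namespace Graphing

/-- `G` together with the measure `μ` is a graphing (measure-preserving graph): the adjacency
relation is Borel, and it is generated by finitely many measure-preserving Borel bijections
between Borel subsets of the vertex set.  (That `V` is standard Borel and that `μ` is a
probability measure is expressed by the type classes in the theorem.) -/
structure IsGraphing {V : Type u} [MeasurableSpace V] (G : SimpleGraph V) (μ : Measure V) :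
    Prop where
  measurableSet_adj : MeasurableSet {p : V × V | G.Adj p.1 p.2}
  exists_maps : ∃ (k : ℕ) (A B : Fin k → Set V) (φ : ∀ i, A i ≃ᵐ B i),
    (∀ i, MeasurableSet (A i)) ∧ (∀ i, MeasurableSet (B i)) ∧
    (∀ i, MeasurePreserving (φ i)
      (μ.comap (Subtype.val : A i → V)) (μ.comap (Subtype.val : B i → V))) ∧
    ∀ x y, G.Adj x y ↔ x ≠ y ∧
      ∃ i, (∃ h : x ∈ A i, (φ i ⟨x, h⟩ : V) = y) ∨ (∃ h : y ∈ A i, (φ i ⟨y, h⟩ : V) = x)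

/-- The degree of a vertex, as an extended natural number. -/
noncomputable def deg {V : Type u} (G : SimpleGraph V) (x : V) : ℕ∞ :=
  (G.neighborSet x).encard

/-- Distinct elements of `X` are at distance strictly larger than `r`
(at infinite distance if they lie in different components). -/
def IsSparse {V : Type u} (G : SimpleGraph V) (r : ℕ) (X : Set V) : Prop :=
  ∀ x ∈ X, ∀ y ∈ X, x ≠ y → (r : ℕ∞) < G.edist x y

/-- Every vertex is at distance at most `r` from `X`. -/
def IsDense {V : Type u} (G : SimpleGraph V) (r : ℕ) (X : Set V) : Prop :=
  ∀ x, ∃ y ∈ X, G.edist x y ≤ (r : ℕ∞)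

/-- The `k`-neighbourhood of a set of vertices (it contains the set itself). -/
def nbhd {V : Type u} (G : SimpleGraph V) (k : ℕ) (X : Set V) : Set V :=
  {x | ∃ y ∈ X, G.edist x y ≤ (k : ℕ∞)}

/-- Every connectivity component is infinite. -/
def AllComponentsInfinite {V : Type u} (G : SimpleGraph V) : Prop :=
  ∀ C : G.ConnectedComponent, C.supp.Infinite

def NoOddCycles {V : Type u} (G : SimpleGraph V) : Prop :=
  ∀ (v : V) (p : G.Walk v v), p.IsCycle → ¬ Odd p.length

/-- A stump (relative to `d`): a finite set of at least two vertices inside an infinite component,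
with at most `d - 1` edges to its complement, all of whose vertices have degree `d` except for at
most one vertex of degree `d + 1`. -/
structure IsStump {V : Type u} (G : SimpleGraph V) (d : ℕ) (A : Set V) : Prop where
  inside : ∃ C : G.ConnectedComponent, C.supp.Infinite ∧ A ⊆ C.supp
  finite : A.Finite
  two_le : 2 ≤ A.encard
  boundary : {p : V × V | p.1 ∈ A ∧ p.2 ∉ A ∧ G.Adj p.1 p.2}.encard + 1 ≤ (d : ℕ∞)
  degrees : ∀ x ∈ A, deg G x = (d : ℕ∞) ∨ deg G x = (d : ℕ∞) + 1
  exceptional : {x | x ∈ A ∧ deg G x = (d : ℕ∞) + 1}.Subsingleton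

def NoStumps {V : Type u} (G : SimpleGraph V) (d : ℕ) : Prop :=
  ∀ A : Set V, ¬ IsStump G d A

/-- A Borel matching of `G`; the set of covered vertices is `M.verts`. -/
structure IsBorelMatching {V : Type u} [MeasurableSpace V] {G : SimpleGraph V}
    (M : G.Subgraph) : Prop where
  isMatching : M.IsMatching
  measurableSet_adj : MeasurableSet {p : V × V | M.Adj p.1 p.2}

/-- The star of `x`: the vertices of degree exactly `d` at distance at most one from `x`. -/
def star {V : Type u} (G : SimpleGraph V) (d : ℕ) (x : V) : Set V :=
  {y | y ∈ nbhd G 1 {x} ∧ deg G y = (d : ℕ∞)}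

/-- The star of `x` is complete: all of its vertices are covered by `M`. -/
def IsCompleteStar {V : Type u} {G : SimpleGraph V} (d : ℕ) (M : G.Subgraph) (x : V) : Prop :=
  star G d x ⊆ M.verts

/-- `e` chooses, for each `x ∈ K` whose star has uncovered vertices, one of them, in a Borel way.
This is the vertex that is left out of the truncated star. -/
structure IsExclusion {V : Type u} [MeasurableSpace V] {G : SimpleGraph V} (d : ℕ)
    (M : G.Subgraph) (K : Set V) (e : V → V) : Prop where
  measurable : Measurable e
  mem : ∀ x ∈ K, (star G d x \ M.verts).Nonempty → e x ∈ star G d x \ M.verts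

/-- The truncated star: all uncovered vertices of the star except for the excluded one. -/
def truncatedStar {V : Type u} {G : SimpleGraph V} (d : ℕ) (M : G.Subgraph) (e : V → V)
    (x : V) : Set V :=
  (star G d x \ M.verts) \ {e x}

/-- The set of unhappy vertices. -/
def unhappy {V : Type u} {G : SimpleGraph V} (d : ℕ) (M : G.Subgraph) (K : Set V)
    (e : V → V) : Set V :=
  {x | x ∉ nbhd G 1 K ∧ (d : ℕ∞) ≤ deg G x ∧ x ∉ M.verts} ∪ ⋃ x ∈ K, truncatedStar d M e x

/-- Alternating path: it starts in an uncovered vertex and its edges are alternately outside and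
inside `M` (the first one is outside, since the first vertex is uncovered). -/
def IsAlternatingPath {V : Type u} {G : SimpleGraph V} (M : G.Subgraph) {u v : V}
    (p : G.Walk u v) : Prop :=
  p.IsPath ∧ u ∉ M.verts ∧
    ∀ i < p.length, (M.Adj (p.getVert i) (p.getVert (i + 1)) ↔ Odd i)

/-- Augmenting path: an alternating path that starts in an unhappy vertex and either is odd and
ends in an uncovered vertex, or is even and ends in a vertex of degree less than `d` or in a
vertex of the complete star of some element of `K`. -/
def IsAugmentingPath {V : Type u} {G : SimpleGraph V} (d : ℕ) (M : G.Subgraph) (K : Set V)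
    (e : V → V) {u v : V} (p : G.Walk u v) : Prop :=
  IsAlternatingPath M p ∧ u ∈ unhappy d M K e ∧
    ((Odd p.length ∧ v ∉ M.verts) ∨
      (Even p.length ∧
        (deg G v < (d : ℕ∞) ∨ ∃ x ∈ K, IsCompleteStar d M x ∧ v ∈ star G d x)))

end Graphing

/-! Write `U` for the set of unhappy vertices, `E_t` for the vertices reached from `U` by even
alternating paths with at most `t` double steps, `O_t` for the partners of vertices of `E_{t+1}`.
Without short augmenting paths, odd alternating paths from `U` end in covered vertices, vertices of
`E_t` have degree at least `d`, and `E_t` avoids complete stars. The matching preserves measure, so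
`μ(E_{t+1}) = μ(U) + μ(O_t)` (`measure_evenReach_succ`). The aim is that `E_t` grows by a constant
factor in a constant number of double steps (`measure_evenReach_growth`). Since its measure never
exceeds 1, iteration forces `μ(U)` to be exponentially small.

Growth comes from counting the edges between `E = E_t` and `T = O_t \ E_t`. A vertex of `T` receives
at most `d` of them, except in the sparse set `J`, and a lossy vertex receives fewer
(`lintegral_edges_le`). Conversely, let `y` lie in `E_{t-A}` but not in `O_{t+A}`. As in Edmonds'
algorithm, an edge between evenly reached vertices closes an odd ear, all of whose vertices become
evenly reached. Adding ears around `y` yields either many vertices near `y`, or a small blossom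
whose outgoing edges all lead to `T` (`exists_closed_blossom`). Without odd cycles or without stumps
there are at least `d` such edges (`near_base_or_boundary`). Vertices near distinct bases are
distinct (`eq_of_isNearBase`), so mass transport bounds the measure of the bases by about `μ(T)`
(`measure_base_le`).

The strict gain comes from `U` and the lossy vertices. Since `K` is dense, every vertex of `E ∪ O`
is within distance `r' + 1` of `U`, of `J ∩ (E ∪ O)` or of a lossy vertex (`subset_nbhd`), and `J ∩
(E ∪ O)` is negligible because balls around `J` are disjoint and contain many reached vertices. -/

namespace Graphing

/-! ### Alternating paths as lists: joining, splitting and reversing -/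

section Combinatorics

variable {V : Type u} {G : SimpleGraph V} {M : G.Subgraph}

/-- `EvenPath M y n x l`: `l` lists (from `x` back to `y`) the vertices of a path from `y` to `x`
that consists of `n` double steps, each of them an edge followed by an edge of `M`. -/
inductive EvenPath {V : Type u} {G : SimpleGraph V} (M : G.Subgraph) (y : V) :
    ℕ → V → List V → Prop
  | nil : EvenPath M y 0 y [y]
  | step {n : ℕ} {x a b : V} {l : List V} : EvenPath M y n x l → G.Adj x a → M.Adj a b →
      a ∉ l → b ∉ l → EvenPath M y (n + 1) b (b :: a :: l)

namespace EvenPath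

variable {y x z : V} {n m : ℕ} {l r : List V}

theorem head_eq (h : EvenPath M y n x l) : ∃ l', l = x :: l' := by
  cases h <;> exact ⟨_, rfl⟩

theorem end_mem (h : EvenPath M y n x l) : x ∈ l := by
  obtain ⟨l', rfl⟩ := h.head_eq; simp

theorem start_mem (h : EvenPath M y n x l) : y ∈ l := by
  induction h with
  | nil => simp
  | step _ _ _ _ _ ih => simp [ih]

theorem length_eq (h : EvenPath M y n x l) : l.length = 2 * n + 1 := by
  induction h with
  | nil => simp
  | step _ _ _ _ _ ih => simp [ih]; ring

theorem nodup (h : EvenPath M y n x l) : l.Nodup := by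
  induction h with
  | nil => simp
  | step _ _ hab ha hb ih =>
    have := hab.ne
    simp [ih, ha, hb, this.symm]

theorem isChain (h : EvenPath M y n x l) : l.IsChain G.Adj := by
  induction h with
  | nil => simp
  | step h hxa hab ha hb ih =>
    obtain ⟨l', rfl⟩ := h.head_eq
    exact List.IsChain.cons_cons hab.adj_sub.symm (List.IsChain.cons_cons hxa.symm ih)

theorem eq_of_zero (h : EvenPath M y 0 x l) : x = y ∧ l = [y] := by
  cases h; exact ⟨rfl, rfl⟩

/-- All vertices but the first one are matched along the path. -/
theorem exists_partner (h : EvenPath M y n x l) {v : V} (hv : v ∈ l) (hne : v ≠ y) :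
    ∃ w ∈ l, M.Adj v w := by
  induction h with
  | nil => simp at hv; exact absurd hv hne
  | @step n x a b l h hxa hab ha hb ih =>
    simp only [List.mem_cons] at hv
    rcases hv with rfl | rfl | hv
    · exact ⟨a, by simp, hab.symm⟩
    · exact ⟨b, by simp, hab⟩
    · obtain ⟨w, hw, h'⟩ := ih hv
      exact ⟨w, by simp [hw], h'⟩

theorem end_partner (h : EvenPath M y n x l) (hne : x ≠ y) :
    ∃ a x' l' n', n = n' + 1 ∧ l = x :: a :: l' ∧ M.Adj a x ∧ EvenPath M y n' x' l' := by
  cases h with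
  | nil => exact absurd rfl hne
  | step h _ hab _ _ => exact ⟨_, _, _, _, rfl, rfl, hab, h⟩

theorem append (h : EvenPath M y n x l) (h' : EvenPath M x m z r)
    (hd : ∀ v ∈ l, v ∈ r → v = x) :
    ∃ l', EvenPath M y (n + m) z l' ∧ ∀ v, v ∈ l' ↔ v ∈ l ∨ v ∈ r := by
  induction h' with
  | nil => exact ⟨l, h, fun v => by simp; rintro rfl; exact h.end_mem⟩
  | @step m x' a b r h' hxa hab ha hb ih =>
    obtain ⟨l', hl', hmem⟩ := ih fun v hv hv' => hd v hv (by simp [hv'])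
    have key : ∀ c, c ∉ r → c ∈ b :: a :: r → c ∉ l' := by
      intro c hc hc' hcl
      rcases (hmem c).1 hcl with h1 | h1
      · exact hc (hd c h1 hc' ▸ h'.start_mem)
      · exact hc h1
    refine ⟨b :: a :: l', hl'.step hxa hab (key a ha (by simp)) (key b hb (by simp)), fun v => ?_⟩
    simp only [List.mem_cons, hmem]; tauto

/-- An even path followed by an edge and a reversed even path ending in `y`. -/
theorem append_reverse (h : EvenPath M z n x l) {w : V} (hxw : G.Adj x w)
    (h' : EvenPath M y m w r) (hd : ∀ v ∈ l, v ∉ r) :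
    ∃ x' l', EvenPath M z (n + m) x' l' ∧ G.Adj x' y ∧ y ∉ l' ∧ ∀ v ∈ l', v ∈ l ∨ v ∈ r := by
  induction h' generalizing n x l with
  | nil => exact ⟨x, l, h, hxw, fun h1 => hd _ h1 (by simp), fun v hv => Or.inl hv⟩
  | @step m x0 a b r h' hxa hab ha hb ih =>
    -- Reversal shifts the pairing: the path enters the matched pair at `b`, leaves it at `a`, and
    -- continues along the edge from `a` to the previous even vertex.
    have h1 := h.step hxw hab.symm (fun hb' => hd b hb' (by simp)) (fun ha' => hd a ha' (by simp))
    obtain ⟨x', l', h2, h3, h4, h5⟩ := ih h1 hxa.symm (by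
      intro v hv
      simp only [List.mem_cons] at hv
      rcases hv with rfl | rfl | hv
      · exact ha
      · exact hb
      · exact fun h6 => hd v hv (by simp [h6]))
    refine ⟨x', l', by convert h2 using 1; ring, h3, h4, fun v hv => ?_⟩
    have := h5 v hv
    simp only [List.mem_cons] at this ⊢; tauto

/-- The path is cut where it first meets `Z`. An even first vertex gives a path ending there; an odd
one means that `Z` is entered through the first edge of a double step. -/
theorem first_hit (h : EvenPath M y n x l) {Z : Set V} (hZ : ∃ v ∈ l, v ∈ Z) :
    (∃ z m l', EvenPath M y m z l' ∧ z ∈ Z ∧ (∀ v ∈ l', v ∈ Z → v = z) ∧ (∀ v ∈ l', v ∈ l) ∧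
      m ≤ n ∧ (m = n → z = x ∧ l' = l)) ∨
    (∃ x' m l' a, EvenPath M y m x' l' ∧ (∀ v ∈ l', v ∉ Z) ∧ G.Adj x' a ∧ a ∈ Z ∧ m < n) := by
  induction h with
  | nil =>
    left
    refine ⟨y, 0, [y], .nil, ?_, by simp, by simp, le_rfl, fun _ => ⟨rfl, rfl⟩⟩
    simpa using hZ
  | @step n x a b l h hxa hab ha hb ih =>
    by_cases hl : ∃ v ∈ l, v ∈ Z
    · rcases ih hl with ⟨z, m, l', h1, h2, h3, h4, h5, h6⟩ | ⟨x', m, l', a', h1, h2, h3, h4, h5⟩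
      · exact .inl ⟨z, m, l', h1, h2, h3, fun v hv => by simp [h4 v hv], by omega,
          fun h => by omega⟩
      · exact .inr ⟨x', m, l', a', h1, h2, h3, h4, by omega⟩
    · push Not at hl
      by_cases haZ : a ∈ Z
      · exact .inr ⟨x, n, l, a, h, hl, hxa, haZ, by omega⟩
      · have hbZ : b ∈ Z := by
          obtain ⟨v, hv, hvZ⟩ := hZ
          simp only [List.mem_cons] at hv
          rcases hv with rfl | rfl | hv
          · exact hvZ
          · exact absurd hvZ haZ
          · exact absurd hvZ (hl v hv)
        refine .inl ⟨b, n + 1, _, h.step hxa hab ha hb, hbZ, ?_, fun v hv => hv, le_rfl,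
          fun _ => ⟨rfl, rfl⟩⟩
        intro v hv hvZ
        simp only [List.mem_cons] at hv
        rcases hv with rfl | rfl | hv
        · rfl
        · exact absurd hvZ haZ
        · exact absurd hvZ (hl v hv)

/-- The path is cut where it last leaves `Z`. Leaving from an even vertex gives the tail that will
serve as an ear; leaving from an odd vertex means that an edge of `M` leaves `Z`, which a blossom
allows only at its base. -/
theorem last_hit (h : EvenPath M y n x l) {Z : Set V} (hZ : ∃ v ∈ l, v ∈ Z) :
    (∃ z m k l' r, EvenPath M y m z l' ∧ EvenPath M z k x r ∧ z ∈ Z ∧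
      (∀ v ∈ r, v ∈ Z → v = z) ∧ m + k = n ∧ (∀ v ∈ r, v ∈ l)) ∨
    (∃ a b m l', EvenPath M y m b l' ∧ M.Adj a b ∧ a ∈ Z ∧ b ∉ Z ∧ m ≤ n) := by
  induction h with
  | nil =>
    left
    exact ⟨y, 0, 0, [y], [y], .nil, .nil, by simpa using hZ, by simp, rfl, by simp⟩
  | @step n x a b l h hxa hab ha hb ih =>
    by_cases hbZ : b ∈ Z
    · exact .inl ⟨b, n + 1, 0, _, [b], h.step hxa hab ha hb, .nil, hbZ, by simp, rfl, by simp⟩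
    by_cases haZ : a ∈ Z
    · exact .inr ⟨a, b, n + 1, _, h.step hxa hab ha hb, hab, haZ, hbZ, le_rfl⟩
    have hl : ∃ v ∈ l, v ∈ Z := by
      obtain ⟨v, hv, hvZ⟩ := hZ
      simp only [List.mem_cons] at hv
      rcases hv with rfl | rfl | hv
      · exact absurd hvZ hbZ
      · exact absurd hvZ haZ
      · exact ⟨v, hv, hvZ⟩
    rcases ih hl with ⟨z, m, k, l', r, h1, h2, h3, h4, h5, h6⟩ | ⟨a', b', m, l', h1, h2, h3, h4, h5⟩
    · refine .inl ⟨z, m, k + 1, l', b :: a :: r, h1, h2.step hxa hab (fun h => ha (h6 _ h))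
        (fun h => hb (h6 _ h)), h3, ?_, by omega, ?_⟩
      · intro v hv hvZ
        simp only [List.mem_cons] at hv
        rcases hv with rfl | rfl | hv
        · exact absurd hvZ hbZ
        · exact absurd hvZ haZ
        · exact h4 v hv hvZ
      · intro v hv
        simp only [List.mem_cons] at hv ⊢
        rcases hv with rfl | rfl | hv
        · simp
        · simp
        · simp [h6 v hv]
    · exact .inr ⟨a', b', m, l', h1, h2, h3, h4, by omega⟩

/-- Every vertex of an even path is the end of an even subpath, or its partner is. -/
theorem subpath (h : EvenPath M y n x l) {v : V} (hv : v ∈ l) :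
    (∃ m ≤ n, ∃ l', EvenPath M y m v l' ∧ ∀ w ∈ l', w ∈ l) ∨
    (∃ b, M.Adj v b ∧ ∃ m ≤ n, ∃ l', EvenPath M y m b l' ∧ ∀ w ∈ l', w ∈ l) := by
  induction h with
  | nil =>
    simp only [List.mem_singleton] at hv
    subst hv
    exact .inl ⟨0, le_rfl, _, .nil, fun w hw => hw⟩
  | @step n x a b l h hxa hab ha hb ih =>
    have h1 := h.step hxa hab ha hb
    simp only [List.mem_cons] at hv
    rcases hv with rfl | rfl | hv
    · exact .inl ⟨_, le_rfl, _, h1, fun w hw => hw⟩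
    · exact .inr ⟨b, hab, _, le_rfl, _, h1, fun w hw => hw⟩
    · rcases ih hv with ⟨m, hm, l', h2, h3⟩ | ⟨b', hb', m, hm, l', h2, h3⟩
      · exact .inl ⟨m, by omega, l', h2, fun w hw => by simp [h3 w hw]⟩
      · exact .inr ⟨b', hb', m, by omega, l', h2, fun w hw => by simp [h3 w hw]⟩

/-- The vertices of an ear are reached by going round it in one of the two directions. -/
theorem ear {z' : V} {k : ℕ} (hr : EvenPath M z' k x r) (hl : EvenPath M y m z l)
    (hzx : G.Adj z x) (hd : ∀ v ∈ l, v ∈ r → v = z') {v : V} (hv : v ∈ r) :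
    (∃ j ≤ k, ∃ r', EvenPath M z' j v r' ∧ ∀ w ∈ r', w ∈ r) ∨
    (∃ j ≤ m + k, ∃ l', EvenPath M y j v l' ∧ ∀ w ∈ l', w ∈ l ∨ w ∈ r) := by
  induction hr generalizing m z l with
  | nil =>
    simp only [List.mem_singleton] at hv
    subst hv
    exact .inl ⟨0, le_rfl, _, .nil, fun w hw => hw⟩
  | @step k x0 a b r h hxa hab ha hb ih =>
    have hbz : b ≠ z' := fun h' => hb (h' ▸ h.start_mem)
    have haz : a ≠ z' := fun h' => ha (h' ▸ h.start_mem)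
    have h1 := hl.step hzx hab.symm (fun h' => hbz (hd b h' (by simp)))
      (fun h' => haz (hd a h' (by simp)))
    simp only [List.mem_cons] at hv
    rcases hv with rfl | rfl | hv
    · exact .inl ⟨_, le_rfl, _, h.step hxa hab ha hb, fun w hw => hw⟩
    · refine .inr ⟨_, by omega, _, h1, fun w hw => ?_⟩
      simp only [List.mem_cons] at hw ⊢; tauto
    · rcases ih h1 hxa.symm (by
        intro v hv hvr
        simp only [List.mem_cons] at hv
        rcases hv with rfl | rfl | hv
        · exact absurd hvr ha
        · exact absurd hvr hb
        · exact hd v hv (by simp [hvr])) hv with ⟨j, hj, r', h2, h3⟩ | ⟨j, hj, l', h2, h3⟩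
      · exact .inl ⟨j, by omega, r', h2, fun w hw => by simp [h3 w hw]⟩
      · refine .inr ⟨j, by omega, l', h2, fun w hw => ?_⟩
        have := h3 w hw
        simp only [List.mem_cons] at this ⊢; tauto

theorem exists_walk (h : EvenPath M y n x l) :
    ∃ p : G.Walk y x, p.IsPath ∧ p.length = 2 * n ∧ ∀ v, v ∈ p.support ↔ v ∈ l := by
  induction h with
  | nil => exact ⟨.nil, by simp, by simp, by simp⟩
  | @step n x a b l h hxa hab ha hb ih =>
    obtain ⟨p, hp, hlen, hs⟩ := ih
    have h1 : (p.concat hxa).IsPath := hp.concat (by rwa [hs]) hxa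
    refine ⟨(p.concat hxa).concat hab.adj_sub, h1.concat ?_ _, ?_, fun v => ?_⟩
    · simp [SimpleGraph.Walk.support_concat, hs, hb, hab.ne.symm]
    · simp [hlen]; ring
    · simp [SimpleGraph.Walk.support_concat, hs]; tauto

end EvenPath

/-! ### Blossoms and the sets of evenly and oddly reached vertices -/

/-- A blossom with base `y`: all of its vertices are reached from `y` by even paths inside it. -/
def IsBlossom (M : G.Subgraph) (y : V) (B : ℕ) (Z : Set V) : Prop :=
  ∀ z ∈ Z, ∃ n ≤ B, ∃ l, EvenPath M y n z l ∧ ∀ v ∈ l, v ∈ Z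

/-- The vertices that are reached from `U` by at most `t` double steps. -/
def evenReach (M : G.Subgraph) (U : Set V) (t : ℕ) : Set V :=
  {x | ∃ u ∈ U, ∃ n ≤ t, ∃ l, EvenPath M u n x l}

/-- The vertices whose partner is reached from `U` by at most `t + 1` double steps. -/
def oddReach (M : G.Subgraph) (U : Set V) (t : ℕ) : Set V :=
  {a | ∃ b ∈ evenReach M U (t + 1), M.Adj a b}

/-- `U` consists of uncovered vertices, and odd alternating paths that start in `U` and have at most
`N` double steps end in covered vertices. -/
structure NoOddAugmenting (M : G.Subgraph) (U : Set V) (N : ℕ) : Prop where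
  isMatching : M.IsMatching
  notMem_verts : ∀ u ∈ U, u ∉ M.verts
  mem_verts : ∀ u ∈ U, ∀ n ≤ N, ∀ x l a, EvenPath M u n x l → G.Adj x a → a ∉ l → a ∈ M.verts

variable {U : Set V}

theorem evenReach_mono {s t : ℕ} (h : s ≤ t) : evenReach M U s ⊆ evenReach M U t :=
  fun _ ⟨u, hu, n, hn, l, hl⟩ => ⟨u, hu, n, hn.trans h, l, hl⟩

theorem oddReach_mono {s t : ℕ} (h : s ≤ t) : oddReach M U s ⊆ oddReach M U t :=
  fun _ ⟨b, hb, hab⟩ => ⟨b, evenReach_mono (by omega) hb, hab⟩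

theorem subset_evenReach (t : ℕ) : U ⊆ evenReach M U t :=
  fun u hu => ⟨u, hu, 0, by omega, _, .nil⟩

theorem matching_unique (hM : M.IsMatching) {a b c : V} (h1 : M.Adj a b) (h2 : M.Adj a c) :
    b = c := by
  obtain ⟨w, _, hw⟩ := hM h1.fst_mem
  rw [hw b h1, hw c h2]

theorem EvenPath.mem_reach {u x : V} {n t : ℕ} {l : List V} (hu : u ∈ U)
    (h : EvenPath M u n x l) (hn : n ≤ t) {v : V} (hv : v ∈ l) :
    v ∈ evenReach M U t ∪ oddReach M U t := by
  rcases h.subpath hv with ⟨m, hm, l', h1, -⟩ | ⟨b, hb, m, hm, l', h1, -⟩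
  · exact .inl ⟨u, hu, m, by omega, l', h1⟩
  · exact .inr ⟨b, ⟨u, hu, m, by omega, l', h1⟩, hb⟩

namespace NoOddAugmenting

variable {N : ℕ}

theorem mem_oddReach (hN : NoOddAugmenting M U N) {u x a : V} {n : ℕ} {l : List V}
    (hu : u ∈ U) (h : EvenPath M u n x l) (hn : n ≤ N) (hxa : G.Adj x a) (ha : a ∉ l) :
    a ∈ oddReach M U n := by
  obtain ⟨b, hab, -⟩ := hN.isMatching (hN.mem_verts u hu n hn x l a h hxa ha)
  refine ⟨b, ⟨u, hu, n + 1, le_rfl, _, h.step hxa hab ha fun hb => ?_⟩, hab⟩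
  have hbu : b ≠ u := fun h' => hN.notMem_verts u hu (h' ▸ hab.snd_mem)
  -- A path containing `b` also contains its partner `a`, so `b` is new because `a` is.
  obtain ⟨w, hw, hbw⟩ := h.exists_partner hb hbu
  exact ha (matching_unique hN.isMatching hab.symm hbw ▸ hw)

/-- A neighbour off the path is oddly reached; one on the path is already reached by a subpath or
through its partner. -/
theorem adj_mem_reach (hN : NoOddAugmenting M U N) {t : ℕ} (ht : t ≤ N) {x a : V}
    (hx : x ∈ evenReach M U t) (hxa : G.Adj x a) : a ∈ evenReach M U t ∪ oddReach M U t := by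
  obtain ⟨u, hu, n, hn, l, h⟩ := hx
  by_cases ha : a ∈ l
  · exact h.mem_reach hu hn ha
  · exact .inr (oddReach_mono hn (hN.mem_oddReach hu h (hn.trans ht) hxa ha))

theorem partner_mem_blossom {y : V} {B : ℕ} {Z : Set V} (hZ : IsBlossom M y B Z) {z : V}
    (hz : z ∈ Z) (hzy : z ≠ y) : ∃ w ∈ Z, M.Adj z w := by
  obtain ⟨n, -, l, h, hl⟩ := hZ z hz
  obtain ⟨w, hw, h'⟩ := h.exists_partner h.end_mem hzy
  exact ⟨w, hl w hw, h'⟩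

/-- A path that enters a blossom from outside through an edge continues oddly to the base. -/
theorem base_mem_oddReach (hN : NoOddAugmenting M U N) {u x w y : V} {n B : ℕ} {l : List V}
    {Z : Set V} (hu : u ∈ U) (h : EvenPath M u n x l) (hl : ∀ v ∈ l, v ∉ Z) (hxw : G.Adj x w)
    (hw : w ∈ Z) (hZ : IsBlossom M y B Z) (hn : n + B ≤ N) : y ∈ oddReach M U (n + B) := by
  obtain ⟨m, hm, r, hr, hrZ⟩ := hZ w hw
  obtain ⟨x', l', h1, h2, h3, -⟩ := h.append_reverse hxw hr fun v hv hv' => hl v hv (hrZ v hv')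
  exact oddReach_mono (by omega) (hN.mem_oddReach hu h1 (by omega) h2 h3)

/-- A short path hits a blossom first in its base. -/
theorem first_hit_blossom (hN : NoOddAugmenting M U N) {u x y : V} {n B t : ℕ} {l : List V}
    {Z : Set V} (hu : u ∈ U) (h : EvenPath M u n x l) (hl : ∃ v ∈ l, v ∈ Z)
    (hZ : IsBlossom M y B Z) (hn : n + B ≤ t) (ht : t ≤ N) (hy : y ∉ oddReach M U t) :
    ∃ m l', EvenPath M u m y l' ∧ (∀ v ∈ l', v ∈ Z → v = y) ∧ (∀ v ∈ l', v ∈ l) ∧ m ≤ n ∧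
      (m = n → y = x ∧ l' = l) := by
  rcases h.first_hit hl with ⟨z, m, l', h1, h2, h3, h4, h5, h6⟩ | ⟨x', m, l', a, h1, h2, h3, h4, h5⟩
  · have : z = y := by
      by_contra hzy
      -- Away from the base, the partner of `z` lies in `Z`. It also precedes `z` on the path,
      -- contradicting the choice of `z` as the first vertex in `Z`.
      obtain ⟨w, hw, hzw⟩ := partner_mem_blossom hZ h2 hzy
      have hzu : z ≠ u := fun h' => hN.notMem_verts u hu (h' ▸ hzw.fst_mem)
      obtain ⟨w', hw', hzw'⟩ := h1.exists_partner h1.end_mem hzu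
      have := matching_unique hN.isMatching hzw hzw'
      subst this
      exact hzw.ne (h3 w hw' hw).symm
    subst this
    exact ⟨m, l', h1, h3, h4, h5, h6⟩
  · exact absurd (oddReach_mono (by omega) (hN.base_mem_oddReach hu h1 h2 h3 h4 hZ (by omega))) hy

/-- The exact number of double steps that are needed to reach a vertex. -/
def _root_.Graphing.HasRank (M : G.Subgraph) (U : Set V) (y : V) (s : ℕ) : Prop :=
  y ∈ evenReach M U s ∧ ∀ s' < s, y ∉ evenReach M U s'

theorem _root_.Graphing.exists_hasRank {y : V} {t : ℕ} (h : y ∈ evenReach M U t) :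
    ∃ s ≤ t, HasRank M U y s := by
  classical
  have hex : ∃ s, y ∈ evenReach M U s := ⟨t, h⟩
  exact ⟨Nat.find hex, Nat.find_min' hex h, Nat.find_spec hex, fun s' hs' => Nat.find_min hex hs'⟩

theorem _root_.Graphing.HasRank.exists_path {y : V} {s : ℕ} (h : HasRank M U y s) :
    ∃ u ∈ U, ∃ l, EvenPath M u s y l := by
  obtain ⟨⟨u, hu, n, hn, l, hl⟩, hmin⟩ := h
  rcases hn.lt_or_eq with hn | rfl
  · exact absurd ⟨u, hu, n, le_rfl, l, hl⟩ (hmin n hn)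
  · exact ⟨u, hu, l, hl⟩

theorem _root_.Graphing.HasRank.le {y u : V} {s m : ℕ} {l : List V} (h : HasRank M U y s)
    (hu : u ∈ U) (hl : EvenPath M u m y l) : s ≤ m := by
  by_contra! h'
  exact h.2 m h' ⟨u, hu, m, le_rfl, l, hl⟩

/-- A shortest path to the base of a blossom meets the blossom only there. -/
theorem shortest_inter_blossom (hN : NoOddAugmenting M U N) {u y : V} {s B t : ℕ} {p : List V}
    {Z : Set V} (hs : HasRank M U y s) (hu : u ∈ U) (hp : EvenPath M u s y p) (hyZ : y ∈ Z)
    (hZ : IsBlossom M y B Z) (hB : s + B ≤ t) (ht : t ≤ N) (hy : y ∉ oddReach M U t) :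
    ∀ v ∈ p, v ∈ Z → v = y := by
  obtain ⟨m, l', h1, h2, h3, h4, h5⟩ :=
    hN.first_hit_blossom hu hp ⟨y, hp.end_mem, hyZ⟩ hZ hB ht hy
  have := hs.le hu h1
  obtain ⟨-, rfl⟩ := h5 (by omega)
  exact h2

/-- The vertices near the base of a blossom belong to no other blossom. -/
theorem eq_of_blossoms_inter (hN : NoOddAugmenting M U N) {y y' w z : V} {s s' t A C₁ C₂ m : ℕ}
    {Z Z' : Set V} {l : List V} (hs : HasRank M U y s) (hs' : HasRank M U y' s') (hss : s ≤ s')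
    (hst : s' ≤ t) (hyZ : y ∈ Z) (hyZ' : y' ∈ Z')
    (hZ : IsBlossom M y (t - s + C₁) Z) (hZ' : IsBlossom M y' (t - s' + C₁) Z')
    (hl : EvenPath M y m z l) (hm : m ≤ C₂) (hlZ : ∀ v ∈ l, v ∈ Z) (hwl : w ∈ l) (hw : w ∈ Z')
    (hA : C₁ + C₂ ≤ A) (ht : t + A ≤ N) (hy : y ∉ oddReach M U (t + A))
    (hy' : y' ∉ oddReach M U (t + A)) : y = y' := by
  obtain ⟨u, hu, p, hp⟩ := hs.exists_path
  have hpZ := hN.shortest_inter_blossom hs hu hp hyZ hZ (by omega) ht hy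
  -- If the shortest path to `y` meets `Z'`, it passes through `y'` after at least `s' ≥ s` double
  -- steps, so `y'` is its end.
  by_cases hpZ' : ∃ v ∈ p, v ∈ Z'
  · obtain ⟨m', l', h1, h2, h3, h4, h5⟩ :=
      hN.first_hit_blossom hu hp hpZ' hZ' (t := t + A) (by omega) ht hy'
    have := hs'.le hu h1
    exact (h5 (by omega)).1.symm
  · push Not at hpZ'
    obtain ⟨q, hq, hqmem⟩ := hp.append hl fun v hv hv' => hpZ v hv (hlZ v hv')
    obtain ⟨m', l', h1, h2, h3, h4, h5⟩ :=
      hN.first_hit_blossom hu hq ⟨w, (hqmem w).2 (.inr hwl), hw⟩ hZ' (t := t + A) (by omega) ht hy'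
    -- Otherwise the path continued to `w` enters `Z'` at `y'`, which therefore lies in `Z`. If `y'
    -- ≠ y`, the partner of `y'` is evenly reached inside `Z`, so `y'` is oddly reached, which is
    -- excluded.
    have hy'l : y' ∈ l := ((hqmem y').1 (h3 y' h1.end_mem)).resolve_left fun h => hpZ' y' h hyZ'
    by_contra hne
    obtain ⟨a, ha, hya⟩ := partner_mem_blossom hZ (hlZ y' hy'l) (Ne.symm hne)
    obtain ⟨n, hn, r, hr, hrZ⟩ := hZ a ha
    obtain ⟨q', hq', -⟩ := hp.append hr fun v hv hv' => hpZ v hv (hrZ v hv')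
    exact hy' ⟨a, ⟨u, hu, s + n, by omega, q', hq'⟩, hya⟩

/-- An edge from a blossom to a reachable vertex outside gives an ear. -/
theorem exists_ear (hN : NoOddAugmenting M U N) {y z x : V} {s t B : ℕ} {Z : Set V}
    (hs : HasRank M U y s) (hyZ : y ∈ Z) (hZ : IsBlossom M y B Z) (hz : z ∈ Z)
    (hzx : G.Adj z x) (hxt : x ∈ evenReach M U t) (ht : t + B ≤ N)
    (hy : y ∉ oddReach M U (t + B)) :
    ∃ z' ∈ Z, ∃ k r, EvenPath M z' k x r ∧ s + k ≤ t ∧ ∀ v ∈ r, v ∈ Z → v = z' := by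
  obtain ⟨u, hu, n, hn, q, hq⟩ := hxt
  by_cases hqZ : ∃ v ∈ q, v ∈ Z
  · rcases hq.last_hit hqZ with ⟨z', m, k, l', r, h1, h2, h3, h4, h5, h6⟩ |
      ⟨a, b, m, l', h1, h2, h3, h4, h5⟩
    · obtain ⟨m', l'', g1, g2, g3, g4, g5⟩ :=
        hN.first_hit_blossom hu h1 ⟨z', h1.end_mem, h3⟩ hZ (t := t + B) (by omega) ht hy
      -- The path meets the base no later than `z'`, so at least `s` double steps precede the ear.
      -- This bounds its length by `t - s`.
      have := hs.le hu g1
      exact ⟨z', h3, k, r, h2, by omega, h4⟩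
    · exfalso
      -- An edge of `M` leaving the blossom must start at the base, which would then be oddly
      -- reached.
      have hay : a = y := by
        by_contra hay
        obtain ⟨w, hw, haw⟩ := partner_mem_blossom hZ h3 hay
        exact h4 (matching_unique hN.isMatching h2 haw ▸ hw)
      subst hay
      exact hy ⟨b, ⟨u, hu, m, by omega, l', h1⟩, h2⟩
  · push Not at hqZ
    exact absurd (oddReach_mono (by omega)
      (hN.base_mem_oddReach hu hq hqZ hzx.symm hz hZ (by omega))) hy

/-- Adding an ear to a blossom. -/
theorem _root_.Graphing.IsBlossom.union_ear {y z x z' : V} {B k : ℕ} {Z : Set V} {r : List V}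
    (hZ : IsBlossom M y B Z) (hz : z ∈ Z) (hzx : G.Adj z x) (hz' : z' ∈ Z)
    (hr : EvenPath M z' k x r) (hrZ : ∀ v ∈ r, v ∈ Z → v = z') :
    IsBlossom M y (B + k) (Z ∪ {v | v ∈ r}) := by
  rintro v (hv | hv)
  · obtain ⟨n, hn, l, h1, h2⟩ := hZ v hv
    exact ⟨n, by omega, l, h1, fun w hw => .inl (h2 w hw)⟩
  · obtain ⟨n, hn, l, h1, h2⟩ := hZ z hz
    -- Vertices of the ear are reached forwards from `z'`, or backwards from `z` across the edge
    -- `zx`; in both cases the path from `y` to that attachment point stays in `Z`.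
    rcases hr.ear h1 hzx (fun w hw hw' => hrZ w hw' (h2 w hw)) hv with
      ⟨j, hj, r', h3, h4⟩ | ⟨j, hj, l', h3, h4⟩
    · obtain ⟨n', hn', l', g1, g2⟩ := hZ z' hz'
      obtain ⟨l'', g3, g4⟩ := g1.append h3 fun w hw hw' => hrZ w (h4 w hw') (g2 w hw)
      refine ⟨n' + j, by omega, l'', g3, fun w hw => ?_⟩
      rcases (g4 w).1 hw with h | h
      · exact .inl (g2 w h)
      · exact .inr (h4 w h)
    · refine ⟨j, by omega, l', h3, fun w hw => ?_⟩
      rcases h4 w hw with h | h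
      · exact .inl (h2 w h)
      · exact .inr h

end NoOddAugmenting

end Combinatorics

/-! ### Near-base sets and closed blossoms -/

section Blossoms

variable {V : Type u} {G : SimpleGraph V} {M : G.Subgraph} {U : Set V} {N : ℕ}

theorem EvenPath.take {y x : V} {k j : ℕ} {r : List V} (h : EvenPath M y k x r) (hj : j ≤ k) :
    ∃ x' r', EvenPath M y j x' r' ∧ ∀ v ∈ r', v ∈ r := by
  induction h with
  | nil => exact ⟨y, _, by rw [Nat.le_zero.1 hj]; exact .nil, fun v hv => hv⟩
  | @step n x a b l h hxa hab ha hb ih =>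
    rcases hj.lt_or_eq with hj | rfl
    · obtain ⟨x', r', h1, h2⟩ := ih (by omega)
      exact ⟨x', r', h1, fun v hv => by simp [h2 v hv]⟩
    · exact ⟨b, _, h.step hxa hab ha hb, fun v hv => hv⟩

theorem EvenPath.exists_odd_cycle {y x : V} {k : ℕ} {r : List V} (h : EvenPath M y k x r)
    (hxy : G.Adj x y) : ∃ p : G.Walk x x, p.IsCycle ∧ Odd p.length := by
  obtain ⟨p, hp, hlen, -⟩ := h.exists_walk
  refine ⟨.cons hxy p, ?_, by simp [hlen]⟩
  rw [SimpleGraph.Walk.cons_isCycle_iff]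
  refine ⟨hp, fun he => ?_⟩
  have := hp.length_eq_one_of_mem_edges (Sym2.eq_swap ▸ he)
  omega

theorem EvenPath.edist_le {y x v : V} {n : ℕ} {l : List V} (h : EvenPath M y n x l)
    (hv : v ∈ l) : G.edist y v ≤ (2 * n : ℕ) := by
  classical
  obtain ⟨p, -, hlen, hs⟩ := h.exists_walk
  refine (p.takeUntil v ((hs v).2 hv)).edist_le.trans ?_
  exact_mod_cast (p.length_takeUntil_le_length _).trans hlen.le

theorem EvenPath.reachable {y x v : V} {n : ℕ} {l : List V} (h : EvenPath M y n x l)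
    (hv : v ∈ l) : G.Reachable y v :=
  SimpleGraph.reachable_of_edist_ne_top fun h' => by
    have := h.edist_le hv
    rw [h'] at this
    exact absurd (top_le_iff.1 this) (ENat.natCast_ne_top _)

theorem evenPath_zero_iff {y x : V} {l : List V} :
    EvenPath M y 0 x l ↔ x = y ∧ l = [y] :=
  ⟨EvenPath.eq_of_zero, by rintro ⟨rfl, rfl⟩; exact .nil⟩

theorem evenPath_succ_iff {y x b a c : V} {n : ℕ} {l : List V} :
    EvenPath M y (n + 1) x (b :: a :: c :: l) ↔ x = b ∧ EvenPath M y n c (c :: l) ∧ G.Adj c a ∧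
      M.Adj a b ∧ a ∉ c :: l ∧ b ∉ c :: l := by
  constructor
  · intro h
    cases h with
    | step h h1 h2 h3 h4 =>
      obtain ⟨l', hl'⟩ := h.head_eq
      obtain ⟨rfl, rfl⟩ := List.cons.inj hl'
      exact ⟨rfl, h, h1, h2, h3, h4⟩
  · rintro ⟨rfl, h, h1, h2, h3, h4⟩
    exact h.step h1 h2 h3 h4

theorem deg_eq_natCast_iff {k : ℕ} {x : V} : deg G x = k ↔
    (k : ℕ∞) ≤ deg G x ∧ ¬ ((k + 1 : ℕ) : ℕ∞) ≤ deg G x := by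
  push_cast
  rw [Order.add_one_le_iff_of_not_isMax (by simp), not_lt, and_comm, le_antisymm_iff]

theorem mem_nbhd_one_iff {X : Set V} {x : V} :
    x ∈ nbhd G 1 X ↔ ∃ y, y ∈ X ∧ (x = y ∨ G.Adj x y) := by
  simp only [nbhd, Nat.cast_one, SimpleGraph.edist_le_one_iff_adj_or_eq, Set.mem_ofPred_eq]
  exact exists_congr fun y => and_congr_right fun _ => or_comm

theorem reachable_of_eq_or_adj {x y : V} (h : x = y ∨ G.Adj x y) : G.Reachable x y := by
  rcases h with rfl | h
  · exact .refl _
  · exact h.reachable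

theorem edist_le_succ_iff {x z : V} {k : ℕ} : G.edist x z ≤ (k + 1 : ℕ) ↔
    ∃ y, G.edist x y ≤ k ∧ (y = z ∨ G.Adj y z) := by
  constructor
  · intro h
    obtain ⟨q, hq⟩ := SimpleGraph.exists_walk_of_edist_ne_top
      (fun h' => ENat.natCast_ne_top _ (top_le_iff.1 (h' ▸ h)))
    rw [← hq] at h
    replace h : q.length ≤ k + 1 := by exact_mod_cast h
    cases q using SimpleGraph.Walk.concatRec with
    | Hnil => exact ⟨_, by simp, .inl rfl⟩
    | Hconcat q hadj _ =>
      rw [SimpleGraph.Walk.length_concat] at h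
      exact ⟨_, q.edist_le.trans (by exact_mod_cast (by omega)), .inr hadj⟩
  · rintro ⟨y, hy, h⟩
    refine G.edist_triangle.trans (?_ : G.edist x y + G.edist y z ≤ _)
    push_cast
    refine add_le_add hy (SimpleGraph.edist_le_one_iff_adj_or_eq.2 h.symm)

theorem reachable_of_edist_le {x y : V} {k : ℕ} (h : G.edist x y ≤ k) : G.Reachable x y :=
  SimpleGraph.reachable_of_edist_ne_top fun h' => ENat.natCast_ne_top _ (top_le_iff.1 (h' ▸ h))

theorem encard_le_of_nodup {S : Set V} {l : List V} (hl : l.Nodup) (h : ∀ v ∈ l, v ∈ S) :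
    (l.length : ℕ∞) ≤ S.encard := by
  classical
  rw [← List.toFinset_card_of_nodup hl, ← Set.encard_coe_eq_coe_finsetCard]
  exact Set.encard_le_encard fun v hv => h v (by simpa using hv)

/-- `w` lies near the base `y` of a blossom. -/
def IsNearBase (M : G.Subgraph) (U : Set V) (t C₁ C₂ : ℕ) (y w : V) : Prop :=
  ∃ s ≤ t, HasRank M U y s ∧ ∃ Z : List V, y ∈ Z ∧ IsBlossom M y (t - s + C₁) {v | v ∈ Z} ∧
    ∃ m ≤ C₂, ∃ z l, EvenPath M y m z l ∧ (∀ v ∈ l, v ∈ Z) ∧ w ∈ l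

theorem IsNearBase.reachable {U : Set V} {t C₁ C₂ : ℕ} {y w : V}
    (h : IsNearBase M U t C₁ C₂ y w) : G.Reachable y w := by
  obtain ⟨s, -, -, Z, -, -, m, -, z, l, hl, -, hw⟩ := h
  exact hl.reachable hw

/-- This disjointness lets each vertex be charged to a single base. `C₁` is the slack in the depth
of the ambient blossom, `C₂` the length of the short path to `w`; only that path has bounded length,
while the blossom may have depth about `t - s`. -/
theorem NoOddAugmenting.eq_of_isNearBase (hN : NoOddAugmenting M U N) {y y' w : V}
    {t A C₁ C₂ : ℕ} (hA : C₁ + C₂ ≤ A) (ht : t + A ≤ N) (hy : y ∉ oddReach M U (t + A))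
    (hy' : y' ∉ oddReach M U (t + A)) (h : IsNearBase M U t C₁ C₂ y w)
    (h' : IsNearBase M U t C₁ C₂ y' w) : y = y' := by
  obtain ⟨s, hst, hs, Z, hyZ, hZ, m, hm, z, l, hl, hlZ, hwl⟩ := h
  obtain ⟨s', hst', hs', Z', hyZ', hZ', m', hm', z', l', hl', hlZ', hwl'⟩ := h'
  rcases le_total s s' with hss | hss
  · exact hN.eq_of_blossoms_inter hs hs' hss hst' hyZ hyZ' hZ hZ' hl hm hlZ hwl (hlZ' w hwl') hA ht
      hy hy'
  · exact (hN.eq_of_blossoms_inter hs' hs hss hst hyZ' hyZ hZ' hZ hl' hm' hlZ' hwl' (hlZ w hwl)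
      hA ht hy' hy).symm

theorem NoOddAugmenting.mem_reach_of_isNearBase (hN : NoOddAugmenting M U N) {y w : V}
    {t A C₁ C₂ : ℕ} (hA : C₁ + C₂ ≤ A) (hAt : A ≤ t) (ht : t + A ≤ N)
    (hyE : y ∈ evenReach M U (t - A)) (hy : y ∉ oddReach M U (t + A))
    (h : IsNearBase M U t C₁ C₂ y w) : w ∈ evenReach M U t ∪ oddReach M U t := by
  obtain ⟨s, hst, hs, Z, hyZ, hZ, m, hm, z, l, hl, hlZ, hwl⟩ := h
  obtain ⟨u, hu, p, hp⟩ := hs.exists_path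
  have hsA : s ≤ t - A := by
    by_contra! h'
    exact hs.2 _ h' hyE
  have hpZ := hN.shortest_inter_blossom hs hu hp hyZ hZ (t := t + A) (by omega) ht hy
  obtain ⟨q, hq, hqmem⟩ := hp.append hl fun v hv hv' => hpZ v hv (hlZ v hv')
  exact hq.mem_reach hu (by omega) ((hqmem w).2 (.inr hwl))

/-- A base of a blossom either has many vertices near it or has a small blossom that no edge to an
evenly reached vertex leaves. -/
theorem NoOddAugmenting.exists_closed_blossom (hN : NoOddAugmenting M U N) {y : V}
    {t A L : ℕ} (hA : L * L + (L * L + L) ≤ A) (hAt : A ≤ t) (ht : t + A ≤ N)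
    (hyE : y ∈ evenReach M U (t - A)) (hy : y ∉ oddReach M U (t + A)) :
    (L : ℕ∞) ≤ {w | IsNearBase M U t (L * L) (L * L + L) y w}.encard ∨
    ∃ Z : List V, y ∈ Z ∧ IsBlossom M y (L * L) {v | v ∈ Z} ∧
      (∀ z ∈ Z, z ∈ evenReach M U t ∧ IsNearBase M U t (L * L) (L * L + L) y z) ∧
      ∀ z ∈ Z, ∀ x, G.Adj z x → x ∉ Z → x ∉ evenReach M U t := by
  by_contra! hcon
  obtain ⟨hsmall, hclosed⟩ := hcon
  obtain ⟨s, hsA, hs⟩ := exists_hasRank hyE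
  obtain ⟨u, hu, p, hp⟩ := hs.exists_path
  have near : ∀ Z : List V, y ∈ Z → IsBlossom M y (t - s + L * L) {v | v ∈ Z} →
      ∀ m ≤ L * L + L, ∀ z l, EvenPath M y m z l → (∀ v ∈ l, v ∈ Z) →
      ∀ w ∈ l, IsNearBase M U t (L * L) (L * L + L) y w :=
    fun Z h1 h2 m hm z l h3 h4 w h5 => ⟨s, by omega, hs, Z, h1, h2, m, hm, z, l, h3, h4, h5⟩
  have weaken : ∀ B, ∀ B' ≥ B, ∀ Z : Set V, IsBlossom M y B Z → IsBlossom M y B' Z :=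
    fun B B' hB' Z hZ z hz =>
      let ⟨n, hn, l, h1, h2⟩ := hZ z hz
      ⟨n, hn.trans hB', l, h1, h2⟩
  -- Each short ear adds at least one vertex and at most `L` to the depth, so `L` rounds give `L`
  -- vertices within depth `L * L`, contradicting `hsmall`.
  have grow : ∀ i ≤ L, ∃ Z : List V, Z.Nodup ∧ y ∈ Z ∧ IsBlossom M y (i * L) {v | v ∈ Z} ∧
      i ≤ Z.length := by
    classical
    intro i
    induction i with
    | zero =>
      intro _
      refine ⟨[y], by simp, by simp, ?_, by simp⟩
      intro z hz
      simp only [List.mem_singleton, Set.mem_ofPred_eq] at hz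
      subst hz
      exact ⟨0, by omega, _, .nil, fun v hv => hv⟩
    | succ i ih =>
      intro hi
      obtain ⟨Z, hnd, hyZ, hZ, hlen⟩ := ih (by omega)
      have hiL : i * L + L ≤ L * L := by nlinarith
      have hZ' := weaken _ (L * L) (by omega) _ hZ
      have hpZ := hN.shortest_inter_blossom hs hu hp hyZ hZ' (t := t + A) (by omega) ht hy
      obtain ⟨z, hz, x, hzx, hxZ, hxt⟩ := hclosed Z hyZ hZ' (by
        intro z hz
        obtain ⟨n, hn, l, h1, h2⟩ := hZ' z hz
        refine ⟨?_, near Z hyZ (weaken _ _ (by omega) _ hZ) n (by omega) z l h1 h2 z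
          h1.end_mem⟩
        obtain ⟨q, hq, hqmem⟩ := hp.append h1 fun v hv hv' => hpZ v hv (h2 v hv')
        exact ⟨u, hu, s + n, by omega, q, hq⟩)
      obtain ⟨z', hz', k, r, hr, hk, hrZ⟩ := hN.exists_ear hs hyZ hZ' hz hzx hxt
        (by omega) (fun h => hy (oddReach_mono (by omega) h))
      have hun := hZ.union_ear hz hzx hz' hr hrZ
      have hset : ({v | v ∈ Z} ∪ {v | v ∈ r} : Set V) = {v | v ∈ (Z ++ r).dedup} := by
        ext v
        rw [Set.mem_union, Set.mem_ofPred_eq, Set.mem_ofPred_eq, Set.mem_ofPred_eq, List.mem_dedup,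
          List.mem_append]
      rw [hset] at hun
      by_cases hkL : k ≤ L
      · refine ⟨(Z ++ r).dedup, List.nodup_dedup _, by simp [hyZ],
          fun v hv => ?_, ?_⟩
        · obtain ⟨n, hn, l, h1, h2⟩ := hun v hv
          exact ⟨n, by rw [add_mul]; omega, l, h1, h2⟩
        · have h1 : (x :: Z).Nodup := List.nodup_cons.2 ⟨hxZ, hnd⟩
          have h2 : (x :: Z).length ≤ (Z ++ r).dedup.length := by
            apply List.Subperm.length_le
            apply h1.subperm
            intro v hv
            simp only [List.mem_cons] at hv
            rcases hv with rfl | hv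
            · simp [hr.end_mem]
            · simp [hv]
          simp only [List.length_cons] at h2
          omega
      -- A long ear ends the growth at once: its first `L` double steps, preceded by a path inside
      -- `Z`, are `2 * L + 1` or more vertices near `y`. The whole ear is kept in the ambient
      -- blossom, whose depth may reach `t - s + L * L`.
      · exfalso
        obtain ⟨x', r', h1, h2⟩ := hr.take (j := L) (by omega)
        obtain ⟨n, hn, l, h3, h4⟩ := hZ z' hz'
        obtain ⟨l', h5, h6⟩ := h3.append h1 fun v hv hv' => hrZ v (h2 v hv') (h4 v hv)
        refine hsmall.not_ge (le_trans ?_ (encard_le_of_nodup h5.nodup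
          (near (Z ++ r).dedup (by simp [hyZ]) (fun v hv => ?_) (n + L) (by omega) x' l' h5 ?_)))
        · rw [h5.length_eq]; exact_mod_cast (by omega)
        · obtain ⟨n, hn, l, h1, h2⟩ := hun v hv
          exact ⟨n, by omega, l, h1, h2⟩
        · intro v hv
          rcases (h6 v).1 hv with h | h
          · have : v ∈ Z := h4 v h
            simp [this]
          · simp [h2 v h]
  obtain ⟨Z, hnd, hyZ, hZ, hlen⟩ := grow L le_rfl
  refine hsmall.not_ge (le_trans (by exact_mod_cast hlen) (encard_le_of_nodup hnd fun w hw => ?_))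
  obtain ⟨n, hn, l, h1, h2⟩ := hZ w hw
  exact near Z hyZ (weaken _ _ (by omega) _ hZ) n (by omega) w l h1 h2 w h1.end_mem

/-- A base of a blossom either has many vertices near it or many edges to oddly reached vertices
near it. -/
theorem NoOddAugmenting.near_base_or_boundary (hN : NoOddAugmenting M U N) {d : ℕ} {y : V}
    {t A L : ℕ} (hA : L * L + (L * L + L) ≤ A) (hAt : A ≤ t) (ht : t + A ≤ N)
    (hdeg : ∀ x, deg G x ≤ (d : ℕ∞) + 1) (hinf : AllComponentsInfinite G)
    (hJ : IsSparse G (4 * (L * L)) {x | deg G x = (d : ℕ∞) + 1})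
    (hG : NoOddCycles G ∨ NoStumps G d)
    (hE : ∀ x ∈ evenReach M U t, (d : ℕ∞) ≤ deg G x)
    (hyE : y ∈ evenReach M U (t - A)) (hy : y ∉ oddReach M U (t + A)) :
    (L : ℕ∞) ≤ {w | IsNearBase M U t (L * L) (L * L + L) y w}.encard ∨
    (d : ℕ∞) ≤ {p : V × V | IsNearBase M U t (L * L) (L * L + L) y p.1 ∧ p.1 ∈ evenReach M U t ∧
      p.2 ∈ oddReach M U t \ evenReach M U t ∧ G.Adj p.1 p.2}.encard := by
  have hytE : y ∈ evenReach M U t := evenReach_mono (by omega) hyE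
  have hT : ∀ z ∈ evenReach M U t, ∀ x, G.Adj z x → x ∉ evenReach M U t →
      x ∈ oddReach M U t \ evenReach M U t := fun z hz x hzx hx =>
    ⟨(hN.adj_mem_reach (by omega) hz hzx).resolve_left hx, hx⟩
  -- If no edge from `y` leads to an evenly reached vertex, all edges at `y`, at least `d` of them,
  -- lead to `T`.
  have single : IsNearBase M U t (L * L) (L * L + L) y y →
      (∀ x, G.Adj y x → x ∉ evenReach M U t) →
      (d : ℕ∞) ≤ {p : V × V | IsNearBase M U t (L * L) (L * L + L) y p.1 ∧
        p.1 ∈ evenReach M U t ∧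
        p.2 ∈ oddReach M U t \ evenReach M U t ∧ G.Adj p.1 p.2}.encard := by
    intro hnear h
    refine (hE y hytE).trans ?_
    have hinj : Function.Injective (fun x : V => (y, x)) := fun a b h => (Prod.mk.inj h).2
    rw [deg, ← hinj.encard_image]
    refine Set.encard_le_encard ?_
    rintro _ ⟨x, hx, rfl⟩
    exact ⟨hnear, hytE, hT y hytE x hx (h x hx), hx⟩
  have triv : IsBlossom M y 0 {v | v ∈ [y]} := by
    intro z hz
    simp only [List.mem_singleton, Set.mem_ofPred_eq] at hz
    subst hz
    exact ⟨0, by omega, _, .nil, fun v hv => hv⟩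
  obtain ⟨s, hsA, hs⟩ := exists_hasRank hyE
  have hnear : IsNearBase M U t (L * L) (L * L + L) y y :=
    ⟨s, by omega, hs, [y], by simp, fun z hz => let ⟨n, hn, h⟩ := triv z hz; ⟨n, by omega, h⟩,
      0, by omega, y, [y], .nil, fun v hv => hv, by simp⟩
  rcases hG with hG | hG
  -- An edge from `y` to an evenly reached vertex would give an ear on the trivial blossom, that is,
  -- an odd cycle.
  · refine .inr (single hnear fun x hyx hx => ?_)
    obtain ⟨z', hz', k, r, hr, -, -⟩ := hN.exists_ear hs (by simp) triv (z := y) (by simp) hyx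
      hx (by omega) (fun h => hy (oddReach_mono (by omega) h))
    simp only [List.mem_singleton, Set.mem_ofPred_eq] at hz'
    subst hz'
    obtain ⟨p, hp, hodd⟩ := hr.exists_odd_cycle hyx.symm
    exact hG x p hp hodd
  rcases hN.exists_closed_blossom hA hAt ht hyE hy with h | ⟨Z, hyZ, hZ, hZE, hcl⟩
  · exact .inl h
  right
  have hdist : ∀ z ∈ Z, G.edist y z ≤ (2 * (L * L) : ℕ) := by
    intro z hz
    obtain ⟨n, hn, l, h1, -⟩ := hZ z hz
    exact (h1.edist_le h1.end_mem).trans (by exact_mod_cast (by omega))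
  -- With fewer than `d` boundary edges, a closed blossom of at least two vertices would be a stump.
  -- All of it is within distance `2 * (L * L)` of `y`, so sparseness allows at most one vertex of
  -- degree `d + 1`.
  by_cases h2 : 2 ≤ {v | v ∈ Z}.encard
  · by_contra hcon
    have hb : ¬ (d : ℕ∞) ≤
        {p : V × V | p.1 ∈ {v | v ∈ Z} ∧ p.2 ∉ {v | v ∈ Z} ∧ G.Adj p.1 p.2}.encard := by
      refine fun h => hcon (h.trans (Set.encard_le_encard ?_))
      rintro ⟨z, x⟩ ⟨h1, h2, h3⟩
      exact ⟨(hZE z h1).2, (hZE z h1).1, hT z (hZE z h1).1 x h3 (hcl z h1 x h3 h2), h3⟩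
    refine hG {v | v ∈ Z} ⟨⟨G.connectedComponentMk y, hinf _, fun z hz => ?_⟩, List.finite_toSet Z,
      h2, Order.add_one_le_of_lt (not_le.1 hb), fun x hx => ?_, ?_⟩
    · rw [SimpleGraph.ConnectedComponent.mem_supp_iff, SimpleGraph.ConnectedComponent.eq]
      refine (SimpleGraph.reachable_of_edist_ne_top fun h => ?_).symm
      have := hdist z hz
      rw [h] at this
      exact absurd (top_le_iff.1 this) (ENat.natCast_ne_top _)
    · rcases (hE x (hZE x hx).1).lt_or_eq with h | h
      · exact .inr (le_antisymm (hdeg x) (Order.add_one_le_of_lt h))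
      · exact .inl h.symm
    · rintro a ⟨ha, ha'⟩ b ⟨hb, hb'⟩
      by_contra hne
      refine (hJ a ha' b hb' hne).not_ge ?_
      calc G.edist a b ≤ G.edist a y + G.edist y b := SimpleGraph.edist_triangle
        _ ≤ (2 * (L * L) : ℕ) + (2 * (L * L) : ℕ) := by
          rw [SimpleGraph.edist_comm]; exact add_le_add (hdist a ha) (hdist b hb)
        _ = (4 * (L * L) : ℕ) := by norm_cast; ring
  · refine single hnear fun x hyx => hcl y hyZ x hyx fun hx => h2 ?_
    rw [← Set.encard_pair hyx.ne]
    refine Set.encard_le_encard ?_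
    rintro v (rfl | rfl)
    · exact hyZ
    · exact hx

end Blossoms

/-! ### Partial measure-preserving maps and the mass transport principle -/

section MassTransport

variable {V : Type u} [MeasurableSpace V] {μ : Measure V}

/-- A partial measure-preserving isomorphism of `V`, with total maps in both directions. -/
structure PartialIso (μ : Measure V) where
  source : Set V
  target : Set V
  toFun : V → V
  invFun : V → V
  measurableSet_source : MeasurableSet source
  measurableSet_target : MeasurableSet target
  measurable_toFun : Measurable toFun
  measurable_invFun : Measurable invFun
  mapsTo : ∀ x ∈ source, toFun x ∈ target
  mapsTo_inv : ∀ y ∈ target, invFun y ∈ source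
  left_inv : ∀ x ∈ source, invFun (toFun x) = x
  right_inv : ∀ y ∈ target, toFun (invFun y) = y
  map_restrict : (μ.restrict source).map toFun = μ.restrict target

namespace PartialIso

def refl (μ : Measure V) : PartialIso μ where
  source := Set.univ
  target := Set.univ
  toFun := id
  invFun := id
  measurableSet_source := .univ
  measurableSet_target := .univ
  measurable_toFun := measurable_id
  measurable_invFun := measurable_id
  mapsTo := by simp
  mapsTo_inv := by simp
  left_inv := by simp
  right_inv := by simp
  map_restrict := by simp

def symm (p : PartialIso μ) : PartialIso μ where
  source := p.target
  target := p.source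
  toFun := p.invFun
  invFun := p.toFun
  measurableSet_source := p.measurableSet_target
  measurableSet_target := p.measurableSet_source
  measurable_toFun := p.measurable_invFun
  measurable_invFun := p.measurable_toFun
  mapsTo := p.mapsTo_inv
  mapsTo_inv := p.mapsTo
  left_inv := p.right_inv
  right_inv := p.left_inv
  map_restrict := by
    rw [← p.map_restrict, Measure.map_map p.measurable_invFun p.measurable_toFun]
    conv_rhs => rw [← Measure.map_id (μ := μ.restrict p.source)]
    refine Measure.map_congr ?_
    filter_upwards [ae_restrict_mem p.measurableSet_source] with x hx
    exact p.left_inv x hx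

theorem lintegral_comp (p : PartialIso μ) {f : V → ENNReal} (hf : Measurable f) :
    ∫⁻ x in p.source, f (p.toFun x) ∂μ = ∫⁻ y in p.target, f y ∂μ := by
  rw [← p.map_restrict, lintegral_map hf p.measurable_toFun]

/-- Restriction to a measurable set of sources. -/
def restr (p : PartialIso μ) (S : Set V) (hS : MeasurableSet S) : PartialIso μ where
  source := p.source ∩ S
  target := p.target ∩ p.invFun ⁻¹' S
  toFun := p.toFun
  invFun := p.invFun
  measurableSet_source := p.measurableSet_source.inter hS
  measurableSet_target := p.measurableSet_target.inter (p.measurable_invFun hS)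
  measurable_toFun := p.measurable_toFun
  measurable_invFun := p.measurable_invFun
  mapsTo x hx := ⟨p.mapsTo x hx.1, by simpa [p.left_inv x hx.1] using hx.2⟩
  mapsTo_inv y hy := ⟨p.mapsTo_inv y hy.1, hy.2⟩
  left_inv x hx := p.left_inv x hx.1
  right_inv y hy := p.right_inv y hy.1
  map_restrict := by
    ext T hT
    have h1 : (μ.restrict p.source).map p.toFun (T ∩ p.invFun ⁻¹' S) =
        μ.restrict p.target (T ∩ p.invFun ⁻¹' S) := by rw [p.map_restrict]
    rw [Measure.map_apply p.measurable_toFun (hT.inter (p.measurable_invFun hS)),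
      Measure.restrict_apply (p.measurable_toFun (hT.inter (p.measurable_invFun hS))),
      Measure.restrict_apply (hT.inter (p.measurable_invFun hS))] at h1
    rw [Measure.map_apply p.measurable_toFun hT, Measure.restrict_apply (p.measurable_toFun hT),
      Measure.restrict_apply hT]
    convert h1 using 2
    · ext x
      simp only [Set.mem_inter_iff, Set.mem_preimage]
      constructor
      · rintro ⟨h1, h2, h3⟩
        exact ⟨⟨h1, by rwa [p.left_inv x h2]⟩, h2⟩
      · rintro ⟨⟨h1, h2⟩, h3⟩
        exact ⟨h1, h3, by rwa [p.left_inv x h3] at h2⟩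
    · ext x
      simp only [Set.mem_inter_iff, Set.mem_preimage]; tauto

def trans (p q : PartialIso μ) : PartialIso μ where
  source := p.source ∩ p.toFun ⁻¹' q.source
  target := q.target ∩ q.invFun ⁻¹' p.target
  toFun := q.toFun ∘ p.toFun
  invFun := p.invFun ∘ q.invFun
  measurableSet_source := p.measurableSet_source.inter (p.measurable_toFun q.measurableSet_source)
  measurableSet_target := q.measurableSet_target.inter (q.measurable_invFun p.measurableSet_target)
  measurable_toFun := q.measurable_toFun.comp p.measurable_toFun
  measurable_invFun := p.measurable_invFun.comp q.measurable_invFun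
  mapsTo x hx := ⟨q.mapsTo _ hx.2, by
    simpa [q.left_inv _ hx.2] using p.mapsTo x hx.1⟩
  mapsTo_inv y hy := ⟨p.mapsTo_inv _ hy.2, by
    simpa [p.right_inv _ hy.2] using q.mapsTo_inv y hy.1⟩
  left_inv x hx := by simp [q.left_inv _ hx.2, p.left_inv _ hx.1]
  right_inv y hy := by simp [p.right_inv _ hy.2, q.right_inv _ hy.1]
  map_restrict := by
    -- Both maps are first cut down to the points that meet in `p.target ∩ q.source`.
    have h1 := (p.symm.restr q.source q.measurableSet_source).symm.map_restrict
    have h2 := (q.restr p.target p.measurableSet_target).map_restrict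
    simp only [symm, restr] at h1 h2
    rw [← Measure.map_map q.measurable_toFun p.measurable_toFun, h1, Set.inter_comm, h2]


/-- Composition of a list of partial isomorphisms, the first one being applied first. -/
def word {ι : Type*} (g : ι → PartialIso μ) : List ι → PartialIso μ
  | [] => refl μ
  | i :: l => (g i).trans (word g l)

open Classical in
/-- The extension of a measure-preserving isomorphism between two subsets. -/
noncomputable def ofEquiv {A B : Set V} (hA : MeasurableSet A) (hB : MeasurableSet B)
    (φ : A ≃ᵐ B) (h : MeasurePreserving φ (μ.comap (Subtype.val : A → V))
      (μ.comap (Subtype.val : B → V))) : PartialIso μ where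
  source := A
  target := B
  toFun x := if hx : x ∈ A then φ ⟨x, hx⟩ else x
  invFun y := if hy : y ∈ B then φ.symm ⟨y, hy⟩ else y
  measurableSet_source := hA
  measurableSet_target := hB
  measurable_toFun := Measurable.dite (s := A) (f := fun x => (φ x : V)) (g := fun x => (x : V))
    (measurable_subtype_coe.comp φ.measurable) measurable_subtype_coe hA
  measurable_invFun := Measurable.dite (s := B) (f := fun x => (φ.symm x : V))
    (g := fun x => (x : V)) (measurable_subtype_coe.comp φ.symm.measurable)
    measurable_subtype_coe hB
  mapsTo x hx := by simp [hx]
  mapsTo_inv y hy := by simp [hy]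
  left_inv x hx := by simp [hx]
  right_inv y hy := by simp [hy]
  map_restrict := by
    have hm : Measurable fun x => if hx : x ∈ A then (φ ⟨x, hx⟩ : V) else x :=
      Measurable.dite (s := A) (f := fun x => (φ x : V)) (g := fun x => (x : V))
        (measurable_subtype_coe.comp φ.measurable) measurable_subtype_coe hA
    rw [← map_comap_subtype_coe hA, Measure.map_map hm measurable_subtype_coe,
      ← map_comap_subtype_coe hB, ← h.map_eq, Measure.map_map measurable_subtype_coe φ.measurable]
    congr 1
    ext x
    simp

end PartialIso

/-- A countable family of partial isomorphisms that relates any two vertices of a component exactly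
once. -/
structure IsCover (G : SimpleGraph V) (p : ℕ → PartialIso μ) : Prop where
  exists_of_reachable : ∀ x y, G.Reachable x y → ∃ n, x ∈ (p n).source ∧ (p n).toFun x = y
  unique : ∀ x n m, x ∈ (p n).source → x ∈ (p m).source → (p n).toFun x = (p m).toFun x → n = m

theorem IsGraphing.exists_isCover [MeasurableEq V] {G : SimpleGraph V} (hG : IsGraphing G μ) :
    ∃ p : ℕ → PartialIso μ, IsCover G p := by
  obtain ⟨k, A, B, φ, hA, hB, hφ, hadj⟩ := hG.exists_maps
  let g : Fin k × Bool → PartialIso μ := fun i =>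
    if i.2 then .ofEquiv (hA i.1) (hB i.1) (φ i.1) (hφ i.1)
    else (PartialIso.ofEquiv (hA i.1) (hB i.1) (φ i.1) (hφ i.1)).symm
  have hg : ∀ x y, G.Adj x y → ∃ i, x ∈ (g i).source ∧ (g i).toFun x = y := by
    intro x y hxy
    obtain ⟨-, i, ⟨h, h'⟩ | ⟨h, h'⟩⟩ := (hadj x y).1 hxy
    · exact ⟨(i, true), h, by simp [g, PartialIso.ofEquiv, h, h']⟩
    · have hx : x ∈ B i := h' ▸ (φ i ⟨y, h⟩).2
      refine ⟨(i, false), hx, ?_⟩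
      have : (⟨x, hx⟩ : B i) = φ i ⟨y, h⟩ := Subtype.ext h'.symm
      simp [g, PartialIso.ofEquiv, PartialIso.symm, hx, this]
  have hw : ∀ x y, G.Reachable x y →
      ∃ w, x ∈ (PartialIso.word g w).source ∧ (PartialIso.word g w).toFun x = y := by
    rintro x y ⟨q⟩
    induction q with
    | nil => exact ⟨[], Set.mem_univ _, rfl⟩
    | cons h q ih =>
      obtain ⟨w, h1, h2⟩ := ih
      obtain ⟨i, h3, h4⟩ := hg _ _ h
      exact ⟨i :: w, ⟨h3, by rw [Set.mem_preimage, h4]; exact h1⟩,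
        by simp [PartialIso.word, PartialIso.trans, h4, h2]⟩
  obtain ⟨e, he⟩ := exists_surjective_nat (List (Fin k × Bool))
  -- All words in the generating maps and their inverses are enumerated, and each is restricted to
  -- the points where no earlier word takes the same value.
  let q : ℕ → PartialIso μ := fun n => PartialIso.word g (e n)
  have hS : ∀ n, MeasurableSet
      (⋂ i < n, ((q i).source ∩ {x | (q i).toFun x = (q n).toFun x})ᶜ) := fun n =>
    .iInter fun i => .iInter fun _ => ((q i).measurableSet_source.inter
      (measurableSet_eq_fun (q i).measurable_toFun (q n).measurable_toFun)).compl
  have hmem : ∀ n x, x ∈ ((q n).restr _ (hS n)).source ↔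
      x ∈ (q n).source ∧ ∀ i < n, x ∈ (q i).source → (q i).toFun x ≠ (q n).toFun x := by
    intro n x
    simp [PartialIso.restr]
  refine ⟨fun n => (q n).restr _ (hS n), fun x y hxy => ?_, fun x n m hn hm h => ?_⟩
  · classical
    have hex : ∃ n, x ∈ (q n).source ∧ (q n).toFun x = y := by
      obtain ⟨w, h1⟩ := hw x y hxy
      obtain ⟨n, rfl⟩ := he w
      exact ⟨n, h1⟩
    obtain ⟨h1, h2⟩ := Nat.find_spec hex
    exact ⟨Nat.find hex, (hmem _ _).2 ⟨h1, fun i hi hxi hi' =>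
      Nat.find_min hex hi ⟨hxi, hi'.trans h2⟩⟩, h2⟩
  · rw [hmem] at hn hm
    rcases lt_trichotomy n m with hlt | rfl | hlt
    · exact absurd h (hm.2 n hlt hn.1)
    · rfl
    · exact absurd h.symm (hn.2 m hlt hm.1)

namespace IsCover

variable {G : SimpleGraph V} {p : ℕ → PartialIso μ}

theorem symm (hp : IsCover G p) : IsCover G fun n => (p n).symm where
  exists_of_reachable x y hxy := by
    obtain ⟨n, h1, h2⟩ := hp.exists_of_reachable y x hxy.symm
    exact ⟨n, h2 ▸ (p n).mapsTo _ h1, by rw [← h2]; exact (p n).left_inv _ h1⟩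
  unique x n m hn hm h := by
    refine hp.unique ((p n).invFun x) n m ((p n).mapsTo_inv x hn) ?_ ?_
    · rw [show (p n).invFun x = (p m).invFun x from h]; exact (p m).mapsTo_inv x hm
    · rw [(p n).right_inv x hn, show (p n).invFun x = (p m).invFun x from h, (p m).right_inv x hm]

/-- The cover enumerates the component of `x` without repetition, turning a sum over all vertices
into a countable one. -/
theorem tsum_eq (hp : IsCover G p) {f : V → V → ENNReal}
    (hf : ∀ x y, f x y ≠ 0 → G.Reachable x y) (x : V) :
    ∑' y, f x y = ∑' n, (p n).source.indicator (fun x => f x ((p n).toFun x)) x := by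
  have hinj : Function.Injective fun n : {n | x ∈ (p n).source} => (p n).toFun x :=
    fun n m h => Subtype.ext (hp.unique x n m n.2 m.2 h)
  rw [← hinj.tsum_eq (f := f x), tsum_subtype {n | x ∈ (p n).source} fun n => f x ((p n).toFun x)]
  · refine tsum_congr fun n => ?_
    by_cases h : x ∈ (p n).source
    · rw [Set.indicator_of_mem h, Set.indicator_of_mem (by exact h)]
    · rw [Set.indicator_of_notMem h, Set.indicator_of_notMem (by exact h)]
  · intro y hy
    obtain ⟨n, h1, h2⟩ := hp.exists_of_reachable x y (hf x y hy)
    exact ⟨⟨n, h1⟩, h2⟩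

theorem measurable_tsum (hp : IsCover G p) {f : V → V → ENNReal}
    (hm : Measurable fun q : V × V => f q.1 q.2)
    (hf : ∀ x y, f x y ≠ 0 → G.Reachable x y) : Measurable fun x => ∑' y, f x y := by
  simp_rw [hp.tsum_eq hf]
  exact Measurable.tsum fun n =>
    (hm.comp (measurable_id.prodMk (p n).measurable_toFun)).indicator (p n).measurableSet_source

/-- The mass transport principle. -/
theorem lintegral_tsum_comm (hp : IsCover G p) {f : V → V → ENNReal}
    (hm : Measurable fun q : V × V => f q.1 q.2)
    (hf : ∀ x y, f x y ≠ 0 → G.Reachable x y) :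
    ∫⁻ x, ∑' y, f x y ∂μ = ∫⁻ y, ∑' x, f x y ∂μ := by
  have h1 : ∀ y, ∑' x, f x y =
      ∑' n, (p n).target.indicator (fun y => f ((p n).invFun y) y) y := fun y =>
    hp.symm.tsum_eq (f := fun y x => f x y) (fun y x h => (hf x y h).symm) y
  simp_rw [hp.tsum_eq hf, h1]
  have hl : ∀ n, Measurable fun x => f x ((p n).toFun x) := fun n =>
    hm.comp (measurable_id.prodMk (p n).measurable_toFun)
  have hr : ∀ n, Measurable fun y => f ((p n).invFun y) y := fun n =>
    hm.comp ((p n).measurable_invFun.prodMk measurable_id)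
  rw [lintegral_tsum fun n => ((hl n).indicator (p n).measurableSet_source).aemeasurable,
    lintegral_tsum fun n => ((hr n).indicator (p n).measurableSet_target).aemeasurable]
  refine tsum_congr fun n => ?_
  rw [lintegral_indicator (p n).measurableSet_source, lintegral_indicator (p n).measurableSet_target,
    ← (p n).lintegral_comp (hr n)]
  refine setLIntegral_congr_fun (p n).measurableSet_source fun x hx => ?_
  simp only [(p n).left_inv x hx]

/-! ### Borel quantification over the vertices of a component -/

section Quantifiers

variable {Ω : Type*} [MeasurableSpace Ω]

theorem measurable_exists (hp : IsCover G p) {h : Ω → V} (hh : Measurable h) {P : Ω → V → Prop}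
    (hP : Measurable fun q : Ω × V => P q.1 q.2) (hr : ∀ ω y, P ω y → G.Reachable (h ω) y) :
    Measurable fun ω => ∃ y, P ω y := by
  have : (fun ω => ∃ y, P ω y) = fun ω => ∃ n, P ω ((p n).toFun (h ω)) := by
    ext ω
    constructor
    · rintro ⟨y, hy⟩
      obtain ⟨n, -, rfl⟩ := hp.exists_of_reachable _ _ (hr ω y hy)
      exact ⟨n, hy⟩
    · rintro ⟨n, hn⟩
      exact ⟨_, hn⟩
  rw [this]
  exact Measurable.exists fun n =>
    hP.comp (measurable_id.prodMk ((p n).measurable_toFun.comp hh))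

/-- A list in the component of `h ω` is the image of `h ω` under a word of indices, and there are
only countably many words. -/
theorem measurable_exists_list (hp : IsCover G p) {h : Ω → V} (hh : Measurable h)
    {P : Ω → List V → Prop}
    (hP : ∀ F : List (Ω → V), (∀ f ∈ F, Measurable f) → Measurable fun ω => P ω (F.map (· ω)))
    (hr : ∀ ω l, P ω l → ∀ v ∈ l, G.Reachable (h ω) v) :
    Measurable fun ω => ∃ l, P ω l := by
  have : (fun ω => ∃ l, P ω l) =
      fun ω => ∃ w : List ℕ, P ω ((w.map fun n ω => (p n).toFun (h ω)).map (· ω)) := by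
    ext ω
    constructor
    · rintro ⟨l, hl⟩
      choose! e he using fun v hv => hp.exists_of_reachable _ v (hr ω l hl v hv)
      refine ⟨l.map e, ?_⟩
      convert hl
      rw [List.map_map, List.map_map]
      conv_rhs => rw [← List.map_id l]
      exact List.map_congr_left fun v hv => (he v hv).2
    · rintro ⟨w, hw⟩
      exact ⟨_, hw⟩
  rw [this]
  refine Measurable.exists fun w => hP _ fun f hf => ?_
  simp only [List.mem_map] at hf
  obtain ⟨n, -, rfl⟩ := hf
  exact (p n).measurable_toFun.comp hh

end Quantifiers

end IsCover

end MassTransport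

/-! ### Measurability of the reach sets, near-base relation and unhappy set -/

section Measurability

theorem measurable_forall_mem {V : Type*} {Ω : Type*} [MeasurableSpace Ω] {F : List (Ω → V)}
    {Q : Ω → V → Prop}
    (hQ : ∀ f ∈ F, Measurable fun ω => Q ω (f ω)) :
    Measurable fun ω => ∀ v ∈ F.map (· ω), Q ω v := by
  induction F with
  | nil => simp
  | cons f F ih =>
    simp only [List.map_cons, List.forall_mem_cons]
    exact (hQ f (by simp)).and (ih fun g hg => hQ g (by simp [hg]))

variable {V : Type u} [MeasurableSpace V]
  {Ω : Type*} [MeasurableSpace Ω]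

theorem measurable_rel {R : V → V → Prop} (hR : MeasurableSet {q : V × V | R q.1 q.2})
    {f g : Ω → V} (hf : Measurable f) (hg : Measurable g) : Measurable fun ω => R (f ω) (g ω) :=
  (measurableSet_setOfPred.1 hR).comp (hf.prodMk hg)

theorem measurable_mem_comp {S : Set V} (hS : MeasurableSet S) {f : Ω → V} (hf : Measurable f) :
    Measurable fun ω => f ω ∈ S :=
  measurableSet_setOfPred.1 (hf hS)

theorem measurable_eq_comp [MeasurableEq V] {f g : Ω → V} (hf : Measurable f) (hg : Measurable g) :
    Measurable fun ω => f ω = g ω :=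
  measurableSet_setOfPred.1 (measurableSet_eq_fun hf hg)

theorem measurable_mem_map [MeasurableEq V] {F : List (Ω → V)} (hF : ∀ f ∈ F, Measurable f)
    {g : Ω → V} (hg : Measurable g) : Measurable fun ω => g ω ∈ F.map (· ω) := by
  induction F with
  | nil => simp
  | cons f F ih =>
    simp only [List.map_cons, List.mem_cons]
    exact (measurable_eq_comp hg (hF f (by simp))).or (ih fun g hg => hF g (by simp [hg]))

variable {G : SimpleGraph V} {M : G.Subgraph}

theorem measurable_evenPath [MeasurableEq V] (hG : MeasurableSet {q : V × V | G.Adj q.1 q.2})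
    (hM : MeasurableSet {q : V × V | M.Adj q.1 q.2}) (n : ℕ) {y : Ω → V} (hy : Measurable y)
    {x : Ω → V} (hx : Measurable x) {F : List (Ω → V)} (hF : ∀ f ∈ F, Measurable f) :
    Measurable fun ω => EvenPath M (y ω) n (x ω) (F.map (· ω)) := by
  induction n generalizing x F with
  | zero =>
    simp only [evenPath_zero_iff]
    refine (measurable_eq_comp hx hy).and ?_
    match F with
    | [] => simp
    | [f] => simpa using measurable_eq_comp (hF f (by simp)) hy
    | f :: g :: F => simp
  | succ n ih =>
    have short : ∀ F : List (Ω → V), F.length ≤ 2 →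
        Measurable fun ω => EvenPath M (y ω) (n + 1) (x ω) (F.map (· ω)) := by
      intro F hF
      have : (fun ω => EvenPath M (y ω) (n + 1) (x ω) (F.map (· ω))) = fun _ => False := by
        ext ω
        refine iff_false_intro fun h => ?_
        have := h.length_eq
        rw [List.length_map] at this
        omega
      rw [this]
      exact measurable_const
    match F with
    | [] => exact short _ (by simp)
    | [_] => exact short _ (by simp)
    | [_, _] => exact short _ (by simp)
    | b :: a :: c :: F =>
      have hb := hF b (by simp)
      have ha := hF a (by simp)
      have hc := hF c (by simp)
      have hcF : ∀ f ∈ c :: F, Measurable f := fun f hf => hF f (by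
        simp only [List.mem_cons] at hf ⊢; tauto)
      simp only [List.map_cons, evenPath_succ_iff]
      exact (measurable_eq_comp hx hb).and <| (ih hc hcF).and <| (measurable_rel hG hc ha).and <|
        (measurable_rel hM ha hb).and <| (measurable_mem_map hcF ha).not.and
        (measurable_mem_map hcF hb).not

variable {μ : Measure V} {p : ℕ → PartialIso μ}

theorem IsCover.measurable_isBlossom [MeasurableEq V] (hp : IsCover G p)
    (hG : MeasurableSet {q : V × V | G.Adj q.1 q.2})
    (hM : MeasurableSet {q : V × V | M.Adj q.1 q.2}) (B : ℕ) {y : Ω → V} (hy : Measurable y)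
    {F : List (Ω → V)} (hF : ∀ f ∈ F, Measurable f) :
    Measurable fun ω => IsBlossom M (y ω) B {v | v ∈ F.map (· ω)} := by
  refine measurable_forall_mem (Q := fun ω z => ∃ n ≤ B, ∃ l, EvenPath M (y ω) n z l ∧
    ∀ v ∈ l, v ∈ F.map (· ω)) fun f hf => ?_
  refine Measurable.exists fun n => measurable_const.and ?_
  refine hp.measurable_exists_list hy (fun F' hF' => ?_) fun ω l h v hv => h.1.reachable hv
  exact (measurable_evenPath hG hM n hy (hF f hf) hF').and
    (measurable_forall_mem fun g hg => measurable_mem_map hF (hF' g hg))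

theorem IsCover.measurableSet_evenReach [MeasurableEq V] (hp : IsCover G p)
    (hG : MeasurableSet {q : V × V | G.Adj q.1 q.2})
    (hM : MeasurableSet {q : V × V | M.Adj q.1 q.2}) {U : Set V} (hU : MeasurableSet U) (t : ℕ) :
    MeasurableSet (evenReach M U t) := by
  refine measurableSet_setOfPred.2 ?_
  refine hp.measurable_exists measurable_id (P := fun x u => u ∈ U ∧ ∃ n ≤ t, ∃ l,
    EvenPath M u n x l) ?_ ?_
  · refine (measurable_mem_comp hU measurable_snd).and <| Measurable.exists fun n =>
      measurable_const.and ?_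
    exact hp.measurable_exists_list measurable_snd (fun F hF =>
      measurable_evenPath hG hM n measurable_snd measurable_fst hF) fun ω l h v hv => h.reachable hv
  · rintro x u ⟨-, n, -, l, h⟩
    exact (h.reachable h.end_mem).symm

theorem IsCover.measurableSet_oddReach [MeasurableEq V] (hp : IsCover G p)
    (hG : MeasurableSet {q : V × V | G.Adj q.1 q.2})
    (hM : MeasurableSet {q : V × V | M.Adj q.1 q.2}) {U : Set V} (hU : MeasurableSet U) (t : ℕ) :
    MeasurableSet (oddReach M U t) := by
  refine measurableSet_setOfPred.2 ?_
  refine hp.measurable_exists measurable_id (P := fun a b => b ∈ evenReach M U (t + 1) ∧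
    M.Adj a b) ?_ ?_
  · exact (measurable_mem_comp (hp.measurableSet_evenReach hG hM hU _) measurable_snd).and
      (measurable_rel hM measurable_fst measurable_snd)
  · rintro a b ⟨-, h⟩
    exact h.adj_sub.reachable

theorem IsCover.measurable_isNearBase [MeasurableEq V] (hp : IsCover G p)
    (hG : MeasurableSet {q : V × V | G.Adj q.1 q.2})
    (hM : MeasurableSet {q : V × V | M.Adj q.1 q.2}) {U : Set V} (hU : MeasurableSet U)
    (t C₁ C₂ : ℕ) :
    MeasurableSet {q : V × V | IsNearBase M U t C₁ C₂ q.1 q.2} := by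
  refine measurableSet_setOfPred.2 ?_
  have hE := fun s => measurable_mem_comp (hp.measurableSet_evenReach hG hM hU s)
    (measurable_fst (α := V) (β := V))
  refine Measurable.exists fun s => measurable_const.and <| Measurable.and ((hE s).and <|
    Measurable.forall fun s' => measurable_const.imp (hE s').not) ?_
  refine hp.measurable_exists_list measurable_fst (fun F hF => ?_) ?_
  · refine (measurable_mem_map hF measurable_fst).and <|
      (hp.measurable_isBlossom hG hM _ measurable_fst hF).and <| Measurable.exists fun m =>
        measurable_const.and ?_
    refine hp.measurable_exists measurable_fst (P := fun q z => ∃ l, EvenPath M q.1 m z l ∧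
      (∀ v ∈ l, v ∈ F.map (· q)) ∧ q.2 ∈ l) ?_ ?_
    · refine hp.measurable_exists_list (measurable_fst.comp measurable_fst) (fun F' hF' => ?_)
        fun ω l h v hv => h.1.reachable hv
      refine (measurable_evenPath hG hM m (measurable_fst.comp measurable_fst) measurable_snd
        hF').and <| Measurable.and ?_
        (measurable_mem_map hF' (measurable_snd.comp measurable_fst))
      refine measurable_forall_mem fun g hg => ?_
      have := measurable_mem_map (F := F.map (· ∘ Prod.fst)) (g := g) (fun f hf => ?_) (hF' g hg)
      · simpa [List.map_map, Function.comp_def] using this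
      · simp only [List.mem_map] at hf
        obtain ⟨f, hf, rfl⟩ := hf
        exact (hF f hf).comp measurable_fst
    · rintro q z ⟨l, h, -⟩
      exact h.reachable h.end_mem
  · rintro q Z ⟨-, hZ, -⟩ v hv
    obtain ⟨n, -, l, h, -⟩ := hZ v hv
    exact h.reachable h.end_mem

theorem IsCover.measurable_le_deg [MeasurableEq V] (hp : IsCover G p)
    (hG : MeasurableSet {q : V × V | G.Adj q.1 q.2}) (k : ℕ) :
    MeasurableSet {x | (k : ℕ∞) ≤ deg G x} := by
  classical
  have : {x | (k : ℕ∞) ≤ deg G x} =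
      {x | ∃ l : List V, l.length = k ∧ l.Nodup ∧ ∀ v ∈ l, G.Adj x v} := by
    ext x
    constructor
    · intro h
      obtain ⟨S, hS, hSk⟩ := Set.exists_subset_encard_eq h
      have hfin : S.Finite := Set.finite_of_encard_eq_coe hSk
      refine ⟨hfin.toFinset.toList, ?_, Finset.nodup_toList _, fun v hv => hS (by simpa using hv)⟩
      rw [Finset.length_toList]
      rw [hfin.encard_eq_coe_toFinset_card] at hSk
      exact_mod_cast hSk
    · rintro ⟨l, rfl, hnd, hl⟩
      exact encard_le_of_nodup hnd hl
  rw [this]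
  refine measurableSet_setOfPred.2 ?_
  refine hp.measurable_exists_list measurable_id (fun F hF => ?_) fun x l h v hv =>
    (h.2.2 v hv).reachable
  simp only [List.length_map]
  refine measurable_const.and <| Measurable.and ?_ <|
    measurable_forall_mem fun f hf => measurable_rel hG measurable_id (hF f hf)
  induction F with
  | nil => simp
  | cons f F ih =>
    simp only [List.map_cons, List.nodup_cons]
    exact (measurable_mem_map (fun g hg => hF g (by simp [hg])) (hF f (by simp))).not.and
      (ih fun g hg => hF g (by simp [hg]))

theorem IsCover.measurableSet_deg_eq [MeasurableEq V] (hp : IsCover G p)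
    (hG : MeasurableSet {q : V × V | G.Adj q.1 q.2}) (k : ℕ) :
    MeasurableSet {x | deg G x = (k : ℕ∞)} := by
  simp only [deg_eq_natCast_iff]
  exact (hp.measurable_le_deg hG k).inter (hp.measurable_le_deg hG (k + 1)).compl

theorem IsCover.measurableSet_nbhd_one [MeasurableEq V] (hp : IsCover G p)
    (hG : MeasurableSet {q : V × V | G.Adj q.1 q.2}) {X : Set V} (hX : MeasurableSet X) :
    MeasurableSet (nbhd G 1 X) := by
  have : nbhd G 1 X = {x | ∃ y, y ∈ X ∧ (x = y ∨ G.Adj x y)} := by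
    ext x; exact mem_nbhd_one_iff
  rw [this]
  refine measurableSet_setOfPred.2 (hp.measurable_exists measurable_id ?_ fun x y h =>
    reachable_of_eq_or_adj h.2)
  exact (measurable_mem_comp hX measurable_snd).and <|
    (measurable_eq_comp measurable_fst measurable_snd).or
      (measurable_rel hG measurable_fst measurable_snd)

theorem IsCover.measurableSet_verts (hp : IsCover G p) (hM : IsBorelMatching M) :
    MeasurableSet M.verts := by
  have : M.verts = {x | ∃ y, M.Adj x y} := by
    ext x
    exact ⟨fun hx => (hM.isMatching hx).exists, fun ⟨y, hy⟩ => hy.fst_mem⟩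
  rw [this]
  exact measurableSet_setOfPred.2 (hp.measurable_exists measurable_id
    (measurable_rel hM.measurableSet_adj measurable_fst measurable_snd) fun x y h =>
      h.adj_sub.reachable)

theorem IsCover.measurableSet_unhappy [MeasurableEq V] (hp : IsCover G p)
    (hG : MeasurableSet {q : V × V | G.Adj q.1 q.2}) (hM : IsBorelMatching M) {d : ℕ} {K : Set V}
    (hK : MeasurableSet K) {e : V → V} (he : Measurable e) :
    MeasurableSet (unhappy d M K e) := by
  refine .union (((hp.measurableSet_nbhd_one hG hK).compl).inter
    ((hp.measurable_le_deg hG d).inter (hp.measurableSet_verts hM).compl)) ?_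
  have : (⋃ x ∈ K, truncatedStar d M e x) = {y | ∃ x, x ∈ K ∧ (y = x ∨ G.Adj y x) ∧
      deg G y = (d : ℕ∞) ∧ y ∉ M.verts ∧ ¬ y = e x} := by
    ext y
    simp only [Set.mem_iUnion, truncatedStar, star, Set.mem_sdiff, Set.mem_ofPred_eq,
      mem_nbhd_one_iff, Set.mem_singleton_iff, exists_eq_left, exists_prop]
    exact exists_congr fun x => by tauto
  rw [this]
  refine measurableSet_setOfPred.2 (hp.measurable_exists measurable_id ?_ fun y x h =>
    reachable_of_eq_or_adj h.2.1)
  exact (measurable_mem_comp hK measurable_snd).and <|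
    ((measurable_eq_comp measurable_fst measurable_snd).or
      (measurable_rel hG measurable_fst measurable_snd)).and <|
    (measurable_mem_comp (hp.measurableSet_deg_eq hG d) measurable_fst).and <|
    (measurable_mem_comp (hp.measurableSet_verts hM) measurable_fst).not.and
      (measurable_eq_comp measurable_fst (he.comp measurable_snd)).not

end Measurability

/-! ### Consequences of having no short augmenting path -/

section Augmenting

variable {V : Type u} {G : SimpleGraph V} {M : G.Subgraph}

theorem alternating_concat {u v w : V} {p : G.Walk u v}
    (hp : ∀ i < p.length, (M.Adj (p.getVert i) (p.getVert (i + 1)) ↔ Odd i)) (h : G.Adj v w)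
    (hvw : M.Adj v w ↔ Odd p.length) :
    ∀ i < (p.concat h).length,
      (M.Adj ((p.concat h).getVert i) ((p.concat h).getVert (i + 1)) ↔ Odd i) := by
  intro i hi
  rw [SimpleGraph.Walk.length_concat] at hi
  rw [SimpleGraph.Walk.concat_eq_append, SimpleGraph.Walk.getVert_append,
    SimpleGraph.Walk.getVert_append]
  rcases (Nat.lt_succ_iff.1 hi).lt_or_eq with hi | rfl
  · rw [if_pos hi, ← hp i hi]
    by_cases h1 : i + 1 < p.length
    · rw [if_pos h1]
    · rw [if_neg h1, show i + 1 = p.length by omega]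
      simp
  · rw [if_neg (lt_irrefl _), if_neg (by omega)]
    simpa using hvw

theorem EvenPath.exists_alternating (hM : M.IsMatching) {y x : V} {n : ℕ} {l : List V}
    (h : EvenPath M y n x l) : ∃ p : G.Walk y x, p.IsPath ∧ p.length = 2 * n ∧
      (∀ v, v ∈ p.support ↔ v ∈ l) ∧
      ∀ i < p.length, (M.Adj (p.getVert i) (p.getVert (i + 1)) ↔ Odd i) := by
  induction h with
  | nil => exact ⟨.nil, by simp, by simp, by simp, by simp⟩
  | @step n x a b l h hxa hab ha hb ih =>
    obtain ⟨p, hp, hlen, hs, halt⟩ := ih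
    have h1 : (p.concat hxa).IsPath := hp.concat (by rwa [hs]) hxa
    refine ⟨(p.concat hxa).concat hab.adj_sub, h1.concat ?_ _, ?_, fun v => ?_,
      alternating_concat (alternating_concat halt hxa ?_) hab.adj_sub ?_⟩
    · simp [SimpleGraph.Walk.support_concat, hs, hb, hab.ne.symm]
    · simp [hlen]; ring
    · simp [SimpleGraph.Walk.support_concat, hs]; tauto
    -- `EvenPath` does not ask its first edges to avoid `M`; this follows because `a` is matched to
    -- the new vertex `b`.
    · have : ¬ M.Adj x a := fun h' =>
        hb (matching_unique hM h'.symm hab ▸ h.end_mem)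
      simp [this, hlen]
    · simp [hab, hlen]

variable {d : ℕ} {K : Set V} {e : V → V}

theorem notMem_verts_of_mem_unhappy {u : V} (hu : u ∈ unhappy d M K e) : u ∉ M.verts := by
  rcases hu with hu | hu
  · exact hu.2.2
  · simp only [Set.mem_iUnion] at hu
    obtain ⟨x, -, hu⟩ := hu
    exact hu.1.2

theorem noOddAugmenting_of_noAugmenting {n₀ N : ℕ} (hM : M.IsMatching)
    (h : ∀ (u v : V) (p : G.Walk u v), p.length ≤ n₀ → ¬ IsAugmentingPath d M K e p)
    (hN : 2 * N + 1 ≤ n₀) : NoOddAugmenting M (unhappy d M K e) N where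
  isMatching := hM
  notMem_verts _ := notMem_verts_of_mem_unhappy
  mem_verts u hu n hn x l a hl hxa ha := by
    by_contra hav
    obtain ⟨p, hp, hlen, hs, halt⟩ := hl.exists_alternating hM
    refine h u a (p.concat hxa) (by simp [hlen]; omega)
      ⟨⟨hp.concat (by rwa [hs]) _, notMem_verts_of_mem_unhappy hu,
        alternating_concat halt hxa ?_⟩, hu, .inl ⟨by simp [hlen], hav⟩⟩
    have : ¬ M.Adj x a := fun h' => hav h'.snd_mem
    simp [this, hlen]

theorem evenReach_of_noAugmenting {n₀ N : ℕ} (hM : M.IsMatching)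
    (h : ∀ (u v : V) (p : G.Walk u v), p.length ≤ n₀ → ¬ IsAugmentingPath d M K e p)
    (hN : 2 * N + 1 ≤ n₀) {x : V} (hx : x ∈ evenReach M (unhappy d M K e) N) :
    (d : ℕ∞) ≤ deg G x ∧ ∀ k ∈ K, IsCompleteStar d M k → x ∉ star G d k := by
  obtain ⟨u, hu, n, hn, l, hl⟩ := hx
  obtain ⟨p, hp, hlen, hs, halt⟩ := hl.exists_alternating hM
  have h1 := h u x p (by omega)
  refine ⟨?_, fun k hk hc hxk => ?_⟩
  · by_contra! hd
    exact h1 ⟨⟨hp, notMem_verts_of_mem_unhappy hu, halt⟩, hu,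
      .inr ⟨by simp [hlen], .inl hd⟩⟩
  · exact h1 ⟨⟨hp, notMem_verts_of_mem_unhappy hu, halt⟩, hu,
      .inr ⟨by simp [hlen], .inr ⟨k, hk, hc, hxk⟩⟩⟩

variable {U : Set V} {N : ℕ}

/-- The oddly but not evenly reached vertices that lose an edge. -/
def lossySet (M : G.Subgraph) (d : ℕ) (U : Set V) (t : ℕ) : Set V :=
  {w | w ∈ oddReach M U t \ evenReach M U t ∧
    (¬ (d : ℕ∞) ≤ deg G w ∨ ∃ z, G.Adj w z ∧ z ∉ evenReach M U t)}

/-- Suppose that `v` is far from all three sets. Then its ball consists of reached vertices and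
contains some `k ∈ K` with its neighbours. If the star of `k` is complete, then `k` or one of its
neighbours is evenly reached, has degree `d` and lies in that star, giving an augmenting path. If
not, an uncovered vertex of the star is reached, and a reached uncovered vertex belongs to `U`. -/
theorem NoOddAugmenting.subset_nbhd (hN : NoOddAugmenting M U N) {t r' : ℕ} (ht : t ≤ N)
    (hd : 1 ≤ d) (hdeg : ∀ x, deg G x ≤ (d : ℕ∞) + 1)
    (hE : ∀ x ∈ evenReach M U t, (d : ℕ∞) ≤ deg G x ∧
      ∀ k ∈ K, IsCompleteStar d M k → x ∉ star G d k)
    (hK : IsDense G r' K) :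
    evenReach M U t ∪ oddReach M U t ⊆ nbhd G (r' + 1)
      (U ∪ {x | deg G x = (d : ℕ∞) + 1} ∩ (evenReach M U t ∪ oddReach M U t) ∪
        lossySet M d U t) := by
  intro v hv
  by_contra hcon
  have hfar : ∀ w, G.edist v w ≤ (r' + 1 : ℕ) → w ∉ U ∪ {x | deg G x = (d : ℕ∞) + 1} ∩
      (evenReach M U t ∪ oddReach M U t) ∪ lossySet M d U t := fun w hw hw' => hcon ⟨w, hw', hw⟩
  have hball : ∀ (w : V) (p : G.Walk v w), p.length ≤ r' + 1 →
      w ∈ evenReach M U t ∪ oddReach M U t := by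
    intro w p
    induction p using SimpleGraph.Walk.concatRec with
    | Hnil => exact fun _ => hv
    | Hconcat p h ih =>
      rename_i a b c
      intro hlen
      rw [SimpleGraph.Walk.length_concat] at hlen
      have h1 := ih hv hcon hfar (by omega)
      by_cases h2 : b ∈ evenReach M U t
      · exact hN.adj_mem_reach ht h2 h
      · by_contra h3
        -- The ball stays in the reached set: a vertex of `O \ E` with an unreached neighbour would
        -- be lossy.
        refine hfar b (p.edist_le.trans (by exact_mod_cast (by omega))) (.inr
          ⟨⟨h1.resolve_left h2, h2⟩, .inr ⟨c, h, fun h4 => h3 (.inl h4)⟩⟩)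
  have hnear : ∀ w, G.edist v w ≤ (r' + 1 : ℕ) → w ∈ evenReach M U t ∪ oddReach M U t := by
    intro w hw
    obtain ⟨p, hp⟩ := SimpleGraph.exists_walk_of_edist_ne_top
      (fun h => ENat.natCast_ne_top _ (top_le_iff.1 (h ▸ hw)))
    exact hball w p (by rw [← hp] at hw; exact_mod_cast hw)
  obtain ⟨k, hk, hvk⟩ := hK v
  have hkn : ∀ y, G.edist k y ≤ 1 → G.edist v y ≤ (r' + 1 : ℕ) := fun y hy =>
    G.edist_triangle.trans (by push_cast; exact add_le_add hvk hy)
  have hdeg' : ∀ y, G.edist v y ≤ (r' + 1 : ℕ) → y ∈ evenReach M U t → deg G y = d := by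
    intro y hy hyE
    rcases (hE y hyE).1.lt_or_eq with h | h
    · exact absurd (.inl (.inr ⟨le_antisymm (hdeg y) (Order.add_one_le_of_lt h), .inl hyE⟩))
        (hfar y hy)
    · exact h.symm
  have hk1 := hkn k (by simp)
  have hkstar : ∀ y, G.edist k y ≤ 1 → y ∈ evenReach M U t → y ∈ star G d k := fun y hy hyE =>
    ⟨⟨k, rfl, by rw [SimpleGraph.edist_comm]; exact_mod_cast hy⟩, hdeg' y (hkn y hy) hyE⟩
  by_cases hc : IsCompleteStar d M k
  · rcases hnear k hk1 with hkE | hkO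
    · exact (hE k hkE).2 k hk hc (hkstar k (by simp) hkE)
    · by_cases hkE : k ∈ evenReach M U t
      · exact (hE k hkE).2 k hk hc (hkstar k (by simp) hkE)
      have hkl : _ → False := fun h => hfar k hk1 (.inr ⟨⟨hkO, hkE⟩, h⟩)
      rw [imp_false, not_or, not_not] at hkl
      push Not at hkl
      have hne : (G.neighborSet k).Nonempty := by
        rw [← Set.encard_pos]
        exact lt_of_lt_of_le (Nat.cast_pos.2 hd) hkl.1
      obtain ⟨y, hy⟩ := hne
      have hyE := hkl.2 y hy
      exact (hE y hyE).2 k hk hc (hkstar y (SimpleGraph.edist_eq_one_iff_adj.2 hy).le hyE)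
  · obtain ⟨z, hz, hzM⟩ := Set.not_subset.1 hc
    obtain ⟨⟨k', hk', hzk⟩, -⟩ := hz
    rw [Set.mem_singleton_iff] at hk'
    subst hk'
    have hz1 := hkn z (by rw [SimpleGraph.edist_comm]; exact_mod_cast hzk)
    rcases hnear z hz1 with ⟨u, hu, n, hn, l, hl⟩ | ⟨b, -, hb⟩
    · by_cases hzu : z = u
      · exact hfar z hz1 (.inl (.inl (hzu ▸ hu)))
      · obtain ⟨a, x', l', n', -, -, haz, -⟩ := hl.end_partner hzu
        exact hzM haz.snd_mem
    · exact hzM hb.fst_mem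

theorem edist_getElem_le {x : V} {l : List V} (h : (x :: l).IsChain G.Adj) (i : ℕ)
    (hi : i < (x :: l).length) : G.edist x (x :: l)[i] ≤ i := by
  induction l generalizing x i with
  | nil => simp at hi; subst hi; simp
  | cons y l ih =>
    rw [List.isChain_cons_cons] at h
    rcases i with _ | i
    · simp
    · have hi' : i < (y :: l).length := by simpa using hi
      simp only [List.getElem_cons_succ]
      calc G.edist x (y :: l)[i] ≤ G.edist x y + G.edist y (y :: l)[i] :=
            SimpleGraph.edist_triangle
        _ ≤ 1 + i := add_le_add (SimpleGraph.edist_eq_one_iff_adj.2 h.1).le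
            (ih h.2 i hi')
        _ = ((i + 1 : ℕ) : ℕ∞) := by push_cast; ring

/-- A reached vertex that is far from `U` has many reached vertices around it. -/
theorem NoOddAugmenting.le_encard_ball (hN : NoOddAugmenting M U N) {t ρ : ℕ} {j : V} (hj : j ∈ evenReach M U t ∪ oddReach M U t)
    (hfar : ∀ u ∈ U, (ρ : ℕ∞) < G.edist u j) :
    (ρ : ℕ∞) ≤ {w | w ∈ evenReach M U t ∪ oddReach M U t ∧ G.edist j w ≤ ρ}.encard := by
  obtain ⟨u, hu, l, hnd, hch, hul, hl⟩ : ∃ u ∈ U, ∃ l, (j :: l).Nodup ∧ (j :: l).IsChain G.Adj ∧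
      u ∈ j :: l ∧ ∀ v ∈ j :: l, v ∈ evenReach M U t ∪ oddReach M U t := by
    rcases hj with ⟨u, hu, n, hn, l, hl⟩ | ⟨b, ⟨u, hu, n, hn, l, hl⟩, hjb⟩
    · obtain ⟨l', rfl⟩ := hl.head_eq
      exact ⟨u, hu, l', hl.nodup, hl.isChain, hl.start_mem, fun v hv => hl.mem_reach hu hn hv⟩
    · have hbu : b ≠ u := fun h => hN.notMem_verts u hu (h ▸ hjb.snd_mem)
      obtain ⟨a, x', l', n', rfl, rfl, hab, hl'⟩ := hl.end_partner hbu
      obtain rfl := matching_unique hN.isMatching hab.symm hjb.symm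
      refine ⟨u, hu, l', hl.nodup.of_cons, hl.isChain.of_cons, by simp [hl'.start_mem], ?_⟩
      rintro v (_ | ⟨_, hv⟩)
      · exact .inr ⟨b, ⟨u, hu, _, hn, _, hl⟩, hjb⟩
      · exact hl'.mem_reach hu (by omega) hv
  -- The path from `j` back to `u ∈ U` has more than `ρ` vertices, and its first `ρ` lie in the ball
  -- around `j`.
  obtain ⟨i, hi, hiu⟩ := List.getElem_of_mem hul
  have hlen : ρ < (j :: l).length := by
    have h1 := edist_getElem_le hch i hi
    rw [hiu, SimpleGraph.edist_comm] at h1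
    have h2 := (hfar u hu).trans_le h1
    have : ρ < i := by exact_mod_cast h2
    omega
  have h3 := encard_le_of_nodup (S := {w | w ∈ evenReach M U t ∪ oddReach M U t ∧
    G.edist j w ≤ ρ}) (hnd.sublist (List.take_sublist ρ _)) (fun v hv => by
      obtain ⟨i, hi, rfl⟩ := List.getElem_of_mem hv
      rw [List.length_take] at hi
      rw [List.getElem_take]
      exact ⟨hl _ (List.getElem_mem _), (edist_getElem_le hch i (by omega)).trans
        (by exact_mod_cast (by omega))⟩)
  rwa [List.length_take, min_eq_left hlen.le] at h3

end Augmenting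

/-! ### Measure inequalities obtained by transporting mass -/

section Transport

variable {V : Type u} [MeasurableSpace V] {μ : Measure V} {G : SimpleGraph V}
  {p : ℕ → PartialIso μ}

theorem tsum_indicator_one {α : Type*} (S : Set α) :
    ∑' x, S.indicator (1 : α → ENNReal) x = (S.encard : ENNReal) := by
  rw [← tsum_subtype]
  simp

theorem IsCover.lintegral_encard_comm (hp : IsCover G p) {R : V → V → Prop}
    (hR : MeasurableSet {q : V × V | R q.1 q.2}) (hr : ∀ x y, R x y → G.Reachable x y) :
    ∫⁻ x, ({y | R x y}.encard : ENNReal) ∂μ = ∫⁻ y, ({x | R x y}.encard : ENNReal) ∂μ := by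
  simp_rw [← tsum_indicator_one]
  have h := hp.lintegral_tsum_comm (f := fun x y => {q : V × V | R q.1 q.2}.indicator 1 (x, y))
    (measurable_one.indicator hR) fun x y h => hr x y (Set.mem_of_indicator_ne_zero
      (s := {q : V × V | R q.1 q.2}) h)
  exact h

theorem IsCover.measurable_encard (hp : IsCover G p) {R : V → V → Prop}
    (hR : MeasurableSet {q : V × V | R q.1 q.2}) (hr : ∀ x y, R x y → G.Reachable x y) :
    Measurable fun x => ({y | R x y}.encard : ENNReal) := by
  simp_rw [← tsum_indicator_one]
  exact hp.measurable_tsum (f := fun x y => {q : V × V | R q.1 q.2}.indicator 1 (x, y))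
    (measurable_one.indicator hR) fun x y h => hr x y (Set.mem_of_indicator_ne_zero
      (s := {q : V × V | R q.1 q.2}) h)

/-- Sending mass along a relation: if every point of `A` sends at least `a` and every point receives
at most `b`, and only points of `B` receive anything, then `a * μ A ≤ b * μ B`. -/
theorem IsCover.mul_measure_le (hp : IsCover G p) {R : V → V → Prop}
    (hR : MeasurableSet {q : V × V | R q.1 q.2}) (hr : ∀ x y, R x y → G.Reachable x y)
    {A B : Set V} (hA : MeasurableSet A) (hB : MeasurableSet B) {a b : ℕ}
    (hout : ∀ x ∈ A, (a : ℕ∞) ≤ {y | R x y}.encard)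
    (hin : ∀ y, {x | R x y}.encard ≤ b) (hinB : ∀ x y, R x y → y ∈ B) :
    (a : ENNReal) * μ A ≤ b * μ B := by
  calc (a : ENNReal) * μ A = ∫⁻ x, A.indicator (fun _ => (a : ENNReal)) x ∂μ := by
        rw [lintegral_indicator hA]; simp
    _ ≤ ∫⁻ x, ({y | R x y}.encard : ENNReal) ∂μ := by
        refine lintegral_mono fun x => ?_
        by_cases hx : x ∈ A
        · rw [Set.indicator_of_mem hx]
          simpa using ENat.toENNReal_le.2 (hout x hx)
        · rw [Set.indicator_of_notMem hx]; exact zero_le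
    _ = ∫⁻ y, ({x | R x y}.encard : ENNReal) ∂μ := hp.lintegral_encard_comm hR hr
    _ ≤ ∫⁻ y, B.indicator (fun _ => (b : ENNReal)) y ∂μ := by
        refine lintegral_mono fun y => ?_
        by_cases hy : y ∈ B
        · rw [Set.indicator_of_mem hy]
          simpa using ENat.toENNReal_le.2 (hin y)
        · have : {x | R x y} = ∅ := Set.eq_empty_of_forall_notMem fun x hx => hy (hinB x y hx)
          simp [this]
    _ = b * μ B := by rw [lintegral_indicator hB]; simp

variable [MeasurableEq V]

theorem IsCover.measurableSet_edist_le (hp : IsCover G p)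
    (hG : MeasurableSet {q : V × V | G.Adj q.1 q.2}) (k : ℕ) :
    MeasurableSet {q : V × V | G.edist q.1 q.2 ≤ k} := by
  induction k with
  | zero =>
    simp only [Nat.cast_zero, nonpos_iff_eq_zero, SimpleGraph.edist_eq_zero_iff]
    exact measurableSet_setOfPred.2 (measurable_eq_comp measurable_fst measurable_snd)
  | succ k ih =>
    simp only [edist_le_succ_iff]
    refine measurableSet_setOfPred.2 (hp.measurable_exists measurable_fst ?_ fun q y h =>
      reachable_of_edist_le h.1)
    exact (measurable_rel (R := fun x y => G.edist x y ≤ k) ih (measurable_fst.comp measurable_fst) measurable_snd).and <|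
      (measurable_eq_comp measurable_snd (measurable_snd.comp measurable_fst)).or
        (measurable_rel hG measurable_snd (measurable_snd.comp measurable_fst))

theorem IsCover.measurableSet_nbhd (hp : IsCover G p)
    (hG : MeasurableSet {q : V × V | G.Adj q.1 q.2}) {S : Set V} (hS : MeasurableSet S) (k : ℕ) :
    MeasurableSet (nbhd G k S) :=
  measurableSet_setOfPred.2 (hp.measurable_exists measurable_id
    ((measurable_mem_comp hS measurable_snd).and
      (measurable_rel (R := fun x y => G.edist x y ≤ k)
        (hp.measurableSet_edist_le hG k) measurable_fst measurable_snd))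
    fun _ _ h => reachable_of_edist_le h.2)

/-- Each unit of radius costs a factor `d + 2`, the maximal size of a closed neighbourhood. -/
theorem IsCover.measure_nbhd_le (hp : IsCover G p)
    (hG : MeasurableSet {q : V × V | G.Adj q.1 q.2}) {d : ℕ} (hdeg : ∀ x, deg G x ≤ (d : ℕ∞) + 1)
    {S : Set V} (hS : MeasurableSet S) (k : ℕ) :
    μ (nbhd G k S) ≤ ((d + 2) ^ k : ℕ) * μ S := by
  induction k with
  | zero =>
    have : nbhd G 0 S = S := by
      ext x
      simp [nbhd]
    simp [this]
  | succ k ih =>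
    have h1 := hp.mul_measure_le (R := fun x y => y ∈ nbhd G k S ∧ (x = y ∨ G.Adj x y))
      (A := nbhd G (k + 1) S) (B := nbhd G k S) (a := 1) (b := d + 2)
      (measurableSet_setOfPred.2 ((measurable_mem_comp (hp.measurableSet_nbhd hG hS k)
        measurable_snd).and ((measurable_eq_comp measurable_fst measurable_snd).or
          (measurable_rel hG measurable_fst measurable_snd))))
      (fun x y h => reachable_of_eq_or_adj h.2) (hp.measurableSet_nbhd hG hS _)
      (hp.measurableSet_nbhd hG hS _) ?_ ?_ (fun x y h => h.1)
    · rw [Nat.cast_one, one_mul] at h1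
      refine h1.trans ?_
      calc ((d + 2 : ℕ) : ENNReal) * μ (nbhd G k S)
          ≤ (d + 2 : ℕ) * (((d + 2) ^ k : ℕ) * μ S) := by gcongr
        _ = ((d + 2) ^ (k + 1) : ℕ) * μ S := by rw [← mul_assoc]; push_cast; ring
    · rintro x ⟨z, hz, hxz⟩
      rw [SimpleGraph.edist_comm, edist_le_succ_iff] at hxz
      obtain ⟨y, hy, h⟩ := hxz
      rw [Nat.cast_one, Set.one_le_encard_iff_nonempty]
      refine ⟨y, ⟨z, hz, by rwa [SimpleGraph.edist_comm]⟩, ?_⟩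
      rcases h with rfl | h
      · exact .inl rfl
      · exact .inr h.symm
    · intro y
      calc {x | y ∈ nbhd G k S ∧ (x = y ∨ G.Adj x y)}.encard
          ≤ (insert y (G.neighborSet y)).encard := Set.encard_le_encard (by
            rintro x ⟨-, rfl | h⟩
            · simp
            · exact .inr h.symm)
        _ ≤ (G.neighborSet y).encard + 1 := Set.encard_insert_le _ _
        _ ≤ (d + 1 : ℕ∞) + 1 := add_le_add (hdeg y) le_rfl
        _ = ((d + 2 : ℕ) : ℕ∞) := by push_cast; rw [add_assoc]; rfl

variable {M : G.Subgraph} {U : Set V} {N : ℕ}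

/-- The matching transports measure. -/
theorem IsCover.measure_evenReach_succ (hp : IsCover G p)
    (hG : MeasurableSet {q : V × V | G.Adj q.1 q.2})
    (hM : MeasurableSet {q : V × V | M.Adj q.1 q.2}) (hU : MeasurableSet U)
    (hN : NoOddAugmenting M U N) (t : ℕ) :
    μ (evenReach M U (t + 1)) = μ U + μ (oddReach M U t) := by
  have hE := hp.measurableSet_evenReach hG hM hU (t + 1)
  have hR : MeasurableSet {q : V × V | M.Adj q.1 q.2 ∧ q.2 ∈ evenReach M U (t + 1)} :=
    hM.inter (measurable_snd hE)
  have h1 := hp.mul_measure_le (R := fun a b => M.Adj a b ∧ b ∈ evenReach M U (t + 1))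
    (A := oddReach M U t) (B := evenReach M U (t + 1) \ U) (a := 1) (b := 1) hR
    (fun x y h => h.1.adj_sub.reachable) (hp.measurableSet_oddReach hG hM hU t) (MeasurableSet.diff hE hU)
    ?_ ?_ ?_
  · have h2 := hp.mul_measure_le (R := fun b a => M.Adj a b ∧ b ∈ evenReach M U (t + 1))
      (A := evenReach M U (t + 1) \ U) (B := oddReach M U t) (a := 1) (b := 1)
      (measurable_swap hR)
      (fun x y h => h.1.adj_sub.reachable.symm) (MeasurableSet.diff hE hU)
      (hp.measurableSet_oddReach hG hM hU t) ?_ ?_ ?_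
    · simp only [Nat.cast_one, one_mul] at h1 h2
      rw [le_antisymm h1 h2, add_comm (μ U)]
      exact (measure_sdiff_add_inter (evenReach M U (t + 1)) hU).symm.trans (by
        rw [Set.inter_eq_self_of_subset_right (subset_evenReach _)])
    · rintro b ⟨⟨u, hu, n, hn, l, hl⟩, hbU⟩
      obtain ⟨a, x', l', n', -, -, hab, -⟩ := hl.end_partner fun h => hbU (h ▸ hu)
      rw [Nat.cast_one, Set.one_le_encard_iff_nonempty]
      exact ⟨a, hab, u, hu, n, hn, l, hl⟩
    · intro a
      rw [Nat.cast_one, Set.encard_le_one_iff]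
      exact fun b b' h h' => matching_unique hN.isMatching h.1 h'.1
    · exact fun b a h => ⟨b, h.2, h.1⟩
  · rintro a ⟨b, hb, hab⟩
    rw [Nat.cast_one, Set.one_le_encard_iff_nonempty]
    exact ⟨b, hab, hb⟩
  · intro b
    rw [Nat.cast_one, Set.encard_le_one_iff]
    exact fun a a' h h' => matching_unique hN.isMatching h.1.symm h'.1.symm
  · exact fun a b h => ⟨h.2, fun hbU => hN.notMem_verts b hbU h.1.snd_mem⟩

end Transport

/-! ### Counting the edges between `E` and `O \ E` -/

section Growth

variable {V : Type u} {G : SimpleGraph V} {M : G.Subgraph} {U : Set V} {N d t : ℕ}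

-- The correction `2` on `J` pays for the extra edge and for the lossy unit together. Off `J`, a
-- lossy vertex has degree below `d` or an edge that does not go to `E`, so it can afford its unit.
open Classical in
theorem encard_add_lossy_le (hdeg : ∀ x, deg G x ≤ (d : ℕ∞) + 1) (w : V) :
    {z | z ∈ evenReach M U t ∧ w ∈ oddReach M U t \ evenReach M U t ∧ G.Adj z w}.encard +
      (if w ∈ lossySet M d U t then 1 else 0) ≤
    (if w ∈ oddReach M U t \ evenReach M U t then (d : ℕ∞) else 0) +
      (if w ∈ {x | deg G x = (d : ℕ∞) + 1} ∩ (evenReach M U t ∪ oddReach M U t)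
        then (2 : ℕ∞) else 0) := by
  by_cases hT : w ∈ oddReach M U t \ evenReach M U t
  swap
  · have h1 : w ∉ lossySet M d U t := fun h => hT h.1
    simp [hT, h1]
  have hsub : {z | z ∈ evenReach M U t ∧ w ∈ oddReach M U t \ evenReach M U t ∧ G.Adj z w} ⊆
      G.neighborSet w := fun z hz => hz.2.2.symm
  rw [if_pos hT]
  by_cases hJ : deg G w = (d : ℕ∞) + 1
  · have hJX : w ∈ {x | deg G x = (d : ℕ∞) + 1} ∩ (evenReach M U t ∪ oddReach M U t) :=
      ⟨hJ, .inr hT.1⟩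
    rw [if_pos hJX]
    calc _ ≤ ((d : ℕ∞) + 1) + 1 :=
          add_le_add ((Set.encard_le_encard hsub).trans (hdeg w)) (by split_ifs <;> simp)
      _ = d + 2 := by rw [add_assoc]; rfl
  have hwd : deg G w ≤ d := Order.le_of_lt_add_one (lt_of_le_of_ne (hdeg w) hJ)
  refine le_trans ?_ (le_self_add)
  by_cases hl : w ∈ lossySet M d U t
  · rw [if_pos hl]
    rcases hl.2 with h | ⟨z, hz, hzE⟩
    · exact (add_le_add (Set.encard_le_encard hsub) le_rfl).trans
        (Order.add_one_le_of_lt (not_le.1 h))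
    · calc _ ≤ (G.neighborSet w \ {z}).encard + 1 := by
            refine add_le_add (Set.encard_le_encard fun x hx => ⟨hsub hx, ?_⟩) le_rfl
            rintro rfl
            exact hzE hx.1
        _ = deg G w := Set.encard_sdiff_singleton_add_one hz
        _ ≤ d := hwd
  · rw [if_neg hl, add_zero]
    exact (Set.encard_le_encard hsub).trans hwd

variable [MeasurableSpace V]

theorem measurableSet_edge (hG : MeasurableSet {q : V × V | G.Adj q.1 q.2}) {S T : Set V}
    (hS : MeasurableSet S) (hT : MeasurableSet T) :
    MeasurableSet {q : V × V | q.1 ∈ S ∧ q.2 ∈ T ∧ G.Adj q.1 q.2} :=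
  (measurable_fst hS).inter ((measurable_snd hT).inter hG)

variable [MeasurableEq V] {μ : Measure V} {p : ℕ → PartialIso μ}

theorem IsCover.measurableSet_lossySet (hp : IsCover G p)
    (hG : MeasurableSet {q : V × V | G.Adj q.1 q.2})
    (hM : MeasurableSet {q : V × V | M.Adj q.1 q.2}) (hU : MeasurableSet U) (d t : ℕ) :
    MeasurableSet (lossySet M d U t) := by
  have hE := hp.measurableSet_evenReach hG hM hU t
  refine MeasurableSet.inter (MeasurableSet.diff (hp.measurableSet_oddReach hG hM hU t) hE)
    (.union (hp.measurable_le_deg hG d).compl (measurableSet_setOfPred.2 ?_))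
  exact hp.measurable_exists measurable_id ((measurable_rel hG measurable_fst measurable_snd).and
    (measurable_mem_comp hE measurable_snd).not) fun x y h => h.1.reachable

theorem IsCover.lintegral_edges_le (hp : IsCover G p)
    (hG : MeasurableSet {q : V × V | G.Adj q.1 q.2})
    (hM : MeasurableSet {q : V × V | M.Adj q.1 q.2}) (hU : MeasurableSet U)
    (hdeg : ∀ x, deg G x ≤ (d : ℕ∞) + 1) :
    ∫⁻ z, ({w | z ∈ evenReach M U t ∧ w ∈ oddReach M U t \ evenReach M U t ∧
      G.Adj z w}.encard : ENNReal) ∂μ + μ (lossySet M d U t) ≤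
    d * μ (oddReach M U t \ evenReach M U t) +
      2 * μ ({x | deg G x = (d : ℕ∞) + 1} ∩ (evenReach M U t ∪ oddReach M U t)) := by
  classical
  have hE := hp.measurableSet_evenReach hG hM hU t
  have hO := hp.measurableSet_oddReach hG hM hU t
  have hT := MeasurableSet.diff hO hE
  have hl := hp.measurableSet_lossySet hG hM hU d t
  have hJ : MeasurableSet ({x | deg G x = (d : ℕ∞) + 1} ∩
      (evenReach M U t ∪ oddReach M U t)) := by
    refine MeasurableSet.inter ?_ (hE.union hO)
    have := hp.measurableSet_deg_eq hG (d + 1)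
    push_cast at this
    exact this
  rw [hp.lintegral_encard_comm (R := fun z w => z ∈ evenReach M U t ∧
    w ∈ oddReach M U t \ evenReach M U t ∧ G.Adj z w) (measurableSet_edge hG hE hT)
    fun x y h => h.2.2.reachable]
  rw [← lintegral_indicator_one hl, ← lintegral_add_right _ (measurable_one.indicator hl)]
  calc _ ≤ ∫⁻ w, ((oddReach M U t \ evenReach M U t).indicator (fun _ => (d : ENNReal)) w +
        ({x | deg G x = (d : ℕ∞) + 1} ∩ (evenReach M U t ∪ oddReach M U t)).indicator
          (fun _ => (2 : ENNReal)) w) ∂μ := by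
        refine lintegral_mono fun w => ?_
        have h := ENat.toENNReal_le.2 (encard_add_lossy_le (M := M) (U := U) (t := t) hdeg w)
        simp only [Set.indicator_apply, Pi.one_apply]
        convert h using 1
        · rw [ENat.toENNReal_add]
          congr 1
          split_ifs <;> simp
        · rw [ENat.toENNReal_add]
          congr 1
          · split_ifs <;> simp
          · split_ifs <;> simp
    _ = _ := by
        rw [lintegral_add_left (measurable_const.indicator hT), lintegral_indicator hT,
          lintegral_indicator hJ]
        simp

/-- Each base collects from the vertices `z` near it `L` for every edge from `z` to `T` and `d` for
every such `z` itself. Either alternative of `near_base_or_boundary` yields at least `L * d`, and no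
vertex pays two bases. -/
theorem IsCover.measure_base_le (hp : IsCover G p)
    (hG : MeasurableSet {q : V × V | G.Adj q.1 q.2})
    (hM : MeasurableSet {q : V × V | M.Adj q.1 q.2}) (hU : MeasurableSet U)
    (hN : NoOddAugmenting M U N) {A L : ℕ} (hA : L * L + (L * L + L) ≤ A) (hAt : A ≤ t)
    (ht : t + A ≤ N)
    (hdeg : ∀ x, deg G x ≤ (d : ℕ∞) + 1) (hinf : AllComponentsInfinite G)
    (hJ : IsSparse G (4 * (L * L)) {x | deg G x = (d : ℕ∞) + 1})
    (hGS : NoOddCycles G ∨ NoStumps G d)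
    (hE : ∀ x ∈ evenReach M U t, (d : ℕ∞) ≤ deg G x) :
    (L * d : ENNReal) * μ (evenReach M U (t - A) \ oddReach M U (t + A)) ≤
      L * ∫⁻ z, ({w | z ∈ evenReach M U t ∧ w ∈ oddReach M U t \ evenReach M U t ∧
        G.Adj z w}.encard : ENNReal) ∂μ + d * μ (evenReach M U t ∪ oddReach M U t) := by
  classical
  set E := evenReach M U t with hEdef
  set T := oddReach M U t \ evenReach M U t with hTdef
  set X := evenReach M U t ∪ oddReach M U t with hXdef
  set H := evenReach M U (t - A) \ oddReach M U (t + A) with hHdef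
  have mE : MeasurableSet E := hp.measurableSet_evenReach hG hM hU t
  have mO := hp.measurableSet_oddReach hG hM hU t
  have mT : MeasurableSet T := MeasurableSet.diff mO mE
  have mX : MeasurableSet X := MeasurableSet.union mE mO
  have mH : MeasurableSet H := MeasurableSet.diff (hp.measurableSet_evenReach hG hM hU _)
    (hp.measurableSet_oddReach hG hM hU _)
  set Q : V → V → Prop := fun y z => y ∈ H ∧ IsNearBase M U t (L * L) (L * L + L) y z with hQ
  have mQ : MeasurableSet {q : V × V | Q q.1 q.2} :=
    (measurable_fst mH).inter (hp.measurable_isNearBase hG hM hU _ _ _)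
  set n : V → ENNReal := fun z => ({w | z ∈ E ∧ w ∈ T ∧ G.Adj z w}.encard : ENNReal) with hn
  have mn : Measurable n := hp.measurable_encard (R := fun z w => z ∈ E ∧ w ∈ T ∧ G.Adj z w)
    (measurableSet_edge hG mE mT) fun x y h => h.2.2.reachable
  set h : V → ENNReal := fun z => L * n z + X.indicator (fun _ => (d : ENNReal)) z with hh
  have mh : Measurable h := (mn.const_mul _).add (measurable_const.indicator mX)
  have hout : ∀ y ∈ H, (L * d : ENNReal) ≤ ∑' z, {z | Q y z}.indicator h z := by
    intro y hy
    rcases hN.near_base_or_boundary hA hAt ht hdeg hinf hJ hGS hE hy.1 hy.2 with h1 | h1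
    · calc (L * d : ENNReal) ≤ ({z | Q y z}.encard : ENNReal) * d := by
            gcongr
            simpa [Q, hy] using ENat.toENNReal_le.2 h1
        _ = ∑' z, {z | Q y z}.indicator 1 z * (d : ENNReal) := by
            rw [ENNReal.tsum_mul_right, tsum_indicator_one]
        _ ≤ _ := by
            refine ENNReal.tsum_le_tsum fun z => ?_
            by_cases hz : Q y z
            · have hzX : z ∈ X := hN.mem_reach_of_isNearBase (by omega) hAt ht hy.1 hy.2 hz.2
              rw [Set.indicator_of_mem (by exact hz), Set.indicator_of_mem (by exact hz)]
              simp only [h, Set.indicator_of_mem hzX, Pi.one_apply, one_mul]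
              exact le_add_self
            · rw [Set.indicator_of_notMem (by exact hz)]
              simp
    · calc (L * d : ENNReal) ≤ L * ({q : V × V | Q y q.1 ∧ q.1 ∈ E ∧ q.2 ∈ T ∧
              G.Adj q.1 q.2}.encard : ENNReal) := by
            gcongr
            have he : {q : V × V | Q y q.1 ∧ q.1 ∈ E ∧ q.2 ∈ T ∧ G.Adj q.1 q.2} =
                {q : V × V | IsNearBase M U t (L * L) (L * L + L) y q.1 ∧ q.1 ∈ E ∧ q.2 ∈ T ∧
                  G.Adj q.1 q.2} :=
              Set.ext fun q => ⟨fun h => ⟨h.1.2, h.2⟩, fun h => ⟨⟨hy, h.1⟩, h.2⟩⟩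
            rw [he]
            simpa only [ENat.toENNReal_coe] using ENat.toENNReal_le.2 h1
        _ = L * ∑' z, ∑' w, {q : V × V | Q y q.1 ∧ q.1 ∈ E ∧ q.2 ∈ T ∧
              G.Adj q.1 q.2}.indicator 1 (z, w) := by
            rw [← tsum_indicator_one, ENNReal.tsum_prod']
        _ = ∑' z, (L : ENNReal) * ∑' w, {q : V × V | Q y q.1 ∧ q.1 ∈ E ∧ q.2 ∈ T ∧
              G.Adj q.1 q.2}.indicator 1 (z, w) := by rw [ENNReal.tsum_mul_left]
        _ ≤ _ := by
            refine ENNReal.tsum_le_tsum fun z => ?_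
            by_cases hz : Q y z
            · rw [Set.indicator_of_mem (by exact hz)]
              refine le_trans ?_ (le_self_add (a := L * n z))
              gcongr
              simp only [n]
              rw [← tsum_indicator_one]
              refine ENNReal.tsum_le_tsum fun w => ?_
              refine le_of_eq ?_
              simp [Set.indicator_apply, hz]
            · simp [hz]
  calc (L * d : ENNReal) * μ H = ∫⁻ y, H.indicator (fun _ => (L * d : ENNReal)) y ∂μ := by
        rw [lintegral_indicator mH]; simp
    _ ≤ ∫⁻ y, ∑' z, {q : V × V | Q q.1 q.2}.indicator (fun q => h q.2) (y, z) ∂μ := by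
        refine lintegral_mono fun y => ?_
        by_cases hy : y ∈ H
        · rw [Set.indicator_of_mem hy]
          exact hout y hy
        · rw [Set.indicator_of_notMem hy]; exact zero_le
    _ = ∫⁻ z, ∑' y, {q : V × V | Q q.1 q.2}.indicator (fun q => h q.2) (y, z) ∂μ :=
        hp.lintegral_tsum_comm (f := fun y z => {q : V × V | Q q.1 q.2}.indicator
          (fun q => h q.2) (y, z)) ((mh.comp measurable_snd).indicator mQ) fun y z hyz =>
            (Set.mem_of_indicator_ne_zero (s := {q : V × V | Q q.1 q.2}) hyz).2.reachable
    _ ≤ ∫⁻ z, h z ∂μ := by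
        refine lintegral_mono fun z => ?_
        calc _ = ∑' y, {y | Q y z}.indicator 1 y * h z := by
              refine tsum_congr fun y => ?_
              by_cases hy : Q y z
              · rw [Set.indicator_of_mem (by exact hy), Set.indicator_of_mem (by exact hy)]
                simp
              · rw [Set.indicator_of_notMem (by exact hy), Set.indicator_of_notMem (by exact hy)]
                simp
          _ = ({y | Q y z}.encard : ENNReal) * h z := by
              rw [ENNReal.tsum_mul_right, tsum_indicator_one]
          _ ≤ 1 * h z := by
              gcongr
              have : {y | Q y z}.encard ≤ 1 := by
                rw [Set.encard_le_one_iff]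
                exact fun y y' hy hy' => hN.eq_of_isNearBase (by omega) ht hy.1.2 hy'.1.2 hy.2 hy'.2
              simpa using ENat.toENNReal_le.2 this
          _ = h z := one_mul _
    _ = _ := by
        simp only [h]
        rw [lintegral_add_left (mn.const_mul _), lintegral_const_mul _ mn, lintegral_indicator mX]
        simp

/-- The balls of radius `ρ` around `J` are disjoint, and by `le_encard_ball` each one centred at a
reached vertex contains at least `ρ` reached vertices. -/
theorem IsCover.mul_measure_exceptional_le (hp : IsCover G p)
    (hG : MeasurableSet {q : V × V | G.Adj q.1 q.2})
    (hM : MeasurableSet {q : V × V | M.Adj q.1 q.2}) (hU : MeasurableSet U)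
    (hN : NoOddAugmenting M U N) {J : Set V} (mJ : MeasurableSet J) {ρ : ℕ}
    (hJ : IsSparse G (2 * ρ) J) (hfar : ∀ u ∈ U, ∀ j ∈ J, (ρ : ℕ∞) < G.edist u j) (t : ℕ) :
    (ρ : ENNReal) * μ (J ∩ (evenReach M U t ∪ oddReach M U t)) ≤
      μ (evenReach M U t ∪ oddReach M U t) := by
  have mX := (hp.measurableSet_evenReach hG hM hU t).union (hp.measurableSet_oddReach hG hM hU t)
  have h := hp.mul_measure_le (μ := μ) (a := ρ) (b := 1)
    (R := fun j w => j ∈ J ∧ w ∈ evenReach M U t ∪ oddReach M U t ∧ G.edist j w ≤ ρ)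
    (A := J ∩ (evenReach M U t ∪ oddReach M U t)) (B := evenReach M U t ∪ oddReach M U t)
    ((measurable_fst mJ).inter ((measurable_snd mX).inter (hp.measurableSet_edist_le hG ρ)))
    (fun x y h => reachable_of_edist_le h.2.2) (mJ.inter mX) mX ?_ ?_ (fun x y h => h.2.1)
  · simpa using h
  · rintro j ⟨hj, hjX⟩
    simpa [hj] using hN.le_encard_ball hjX fun u hu => hfar u hu j hj
  · intro w
    rw [Nat.cast_one, Set.encard_le_one_iff]
    rintro j j' ⟨hj, -, hjw⟩ ⟨hj', -, hjw'⟩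
    by_contra hne
    refine (hJ j hj j' hj' hne).not_ge (G.edist_triangle.trans
      (?_ : G.edist j w + G.edist w j' ≤ _))
    rw [SimpleGraph.edist_comm (u := w)]
    exact (add_le_add hjw hjw').trans (by rw [two_mul]; push_cast; rfl)

end Growth

/-! ### The growth inequality and the exponential bound -/

section Main

variable {V : Type u} [MeasurableSpace V] [MeasurableEq V] {G : SimpleGraph V} {M : G.Subgraph}
  {U K : Set V} {μ : Measure V} [IsProbabilityMeasure μ] {p : ℕ → PartialIso μ}

theorem IsCover.measure_evenReach_growth (hp : IsCover G p)
    (hG : MeasurableSet {q : V × V | G.Adj q.1 q.2})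
    (hM : MeasurableSet {q : V × V | M.Adj q.1 q.2}) (hU : MeasurableSet U)
    {N A L D ρ d t r' : ℕ} (hN : NoOddAugmenting M U N) (hd : 1 ≤ d)
    (hD : D = (d + 2) ^ (r' + 1)) (hL : L = 4 * d * D) (hρ : ρ = 12 * D)
    (hA : A = L * L + (L * L + L)) (hAt : A ≤ t) (ht : t + A ≤ N)
    (hdeg : ∀ x, deg G x ≤ (d : ℕ∞) + 1) (hinf : AllComponentsInfinite G)
    (hJ : IsSparse G (4 * (L * L)) {x | deg G x = (d : ℕ∞) + 1})
    (hJ' : IsSparse G (2 * ρ) {x | deg G x = (d : ℕ∞) + 1})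
    (hfar : ∀ u ∈ U, ∀ j ∈ {x | deg G x = (d : ℕ∞) + 1}, (ρ : ℕ∞) < G.edist u j)
    (hGS : NoOddCycles G ∨ NoStumps G d)
    (hE : ∀ x ∈ evenReach M U N, (d : ℕ∞) ≤ deg G x ∧
      ∀ k ∈ K, IsCompleteStar d M k → x ∉ star G d k)
    (hK : IsDense G r' K) :
    (1 + 1 / (2 * d * D)) * μ.real (evenReach M U (t - A)) ≤
      μ.real (evenReach M U (t + A + 1)) := by
  have hEt : ∀ x ∈ evenReach M U t, (d : ℕ∞) ≤ deg G x ∧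
      ∀ k ∈ K, IsCompleteStar d M k → x ∉ star G d k :=
    fun x hx => hE x (evenReach_mono (by omega) hx)
  have mJ : MeasurableSet {x | deg G x = (d : ℕ∞) + 1} := by
    have := hp.measurableSet_deg_eq hG (d + 1)
    push_cast at this
    exact this
  have mE := fun t => hp.measurableSet_evenReach hG hM hU t
  have mO := fun t => hp.measurableSet_oddReach hG hM hU t
  have h1 := hp.measure_base_le hG hM hU hN hA.ge hAt ht hdeg hinf hJ hGS fun x hx => (hEt x hx).1
  have h2 := hp.lintegral_edges_le (M := M) (U := U) (t := t) hG hM hU hdeg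
  have h3 := (measure_mono (μ := μ) (hN.subset_nbhd (by omega) hd hdeg hEt hK)).trans
    (hp.measure_nbhd_le hG hdeg ((hU.union (mJ.inter ((mE t).union (mO t)))).union
      (hp.measurableSet_lossySet hG hM hU d t)) (r' + 1))
  have h4 := hp.mul_measure_exceptional_le hG hM hU hN mJ hJ' hfar t
  have h5 := hp.measure_evenReach_succ hG hM hU hN t
  have h6 := hp.measure_evenReach_succ hG hM hU hN (t + A)
  rw [← hD] at h3
  set E := evenReach M U t with hEdef
  set O := oddReach M U t with hOdef
  set JX := {x | deg G x = (d : ℕ∞) + 1} ∩ (E ∪ O) with hJX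
  set ℓ := lossySet M d U t with hℓ
  set I := ∫⁻ z, ({w | z ∈ E ∧ w ∈ O \ E ∧ G.Adj z w}.encard : ENNReal) ∂μ with hI
  have hIfin : I ≠ ⊤ := by
    refine ne_top_of_le_ne_top ?_ (le_self_add.trans h2)
    finiteness
  replace h1 : (L * d : ℝ) * μ.real (evenReach M U (t - A) \ oddReach M U (t + A)) ≤
      L * I.toReal + d * μ.real (E ∪ O) := by
    have := ENNReal.toReal_mono (by finiteness) h1
    rwa [ENNReal.toReal_add (by finiteness) (by finiteness), ENNReal.toReal_mul, ENNReal.toReal_mul,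
      ENNReal.toReal_mul, ENNReal.toReal_mul, ENNReal.toReal_natCast, ENNReal.toReal_natCast] at this
  replace h2 : I.toReal + μ.real ℓ ≤ d * μ.real (O \ E) + 2 * μ.real JX := by
    have := ENNReal.toReal_mono (by finiteness) h2
    rwa [ENNReal.toReal_add (by finiteness) (by finiteness),
      ENNReal.toReal_add (by finiteness) (by finiteness), ENNReal.toReal_mul,
      ENNReal.toReal_mul, ENNReal.toReal_natCast, ENNReal.toReal_ofNat] at this
  replace h3 : μ.real (E ∪ O) ≤ D * (μ.real U + μ.real JX + μ.real ℓ) := by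
    have := ENNReal.toReal_mono (by finiteness) h3
    rw [ENNReal.toReal_mul, ENNReal.toReal_natCast] at this
    refine this.trans (mul_le_mul_of_nonneg_left ?_ (Nat.cast_nonneg _))
    exact (measureReal_union_le _ _).trans (add_le_add (measureReal_union_le _ _) le_rfl)
  replace h4 : (ρ : ℝ) * μ.real JX ≤ μ.real (E ∪ O) := by
    have := ENNReal.toReal_mono (by finiteness) h4
    rwa [ENNReal.toReal_mul, ENNReal.toReal_natCast] at this
  replace h6 : μ.real (evenReach M U (t + A + 1)) = μ.real U + μ.real (oddReach M U (t + A)) := by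
    have := congrArg ENNReal.toReal h6
    rwa [ENNReal.toReal_add (by finiteness) (by finiteness)] at this
  have h7 : μ.real (O \ E) + μ.real E = μ.real O + μ.real (E \ O) := by
    have g1 := measureReal_sdiff_add_inter (μ := μ) (s := O) (mE t)
    have g2 := measureReal_sdiff_add_inter (μ := μ) (s := E) (mO t)
    rw [Set.inter_comm] at g2
    linarith
  -- Passing to the window from `t - A` to `t + A` costs exactly the increments of `E` and `O`,
  -- which are absorbed into `e₂ - e₁` in `k4`.
  have h8 : μ.real (E \ O) ≤ μ.real (evenReach M U (t - A) \ oddReach M U (t + A)) +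
      (μ.real E - μ.real (evenReach M U (t - A))) +
      (μ.real (oddReach M U (t + A)) - μ.real O) := by
    rw [← measureReal_sdiff (evenReach_mono (by omega)) (mE _),
      ← measureReal_sdiff (oddReach_mono (by omega)) (mO _)]
    refine (measureReal_mono ?_).trans ((measureReal_union_le _ _).trans
      (add_le_add (measureReal_union_le _ _) le_rfl))
    rintro x ⟨hx, hx'⟩
    by_cases g1 : x ∈ evenReach M U (t - A)
    · by_cases g2 : x ∈ oddReach M U (t + A)
      · exact .inr ⟨g2, hx'⟩
      · exact .inl (.inl ⟨g1, g2⟩)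
    · exact .inl (.inr ⟨hx, g1⟩)
  have h9 : μ.real (evenReach M U (t - A)) ≤ μ.real (E ∪ O) :=
    measureReal_mono fun x hx => .inl (evenReach_mono (by omega) hx)
  have hd' : (1 : ℝ) ≤ d := by exact_mod_cast hd
  have hD' : (1 : ℝ) ≤ D := by exact_mod_cast hD ▸ Nat.one_le_pow _ _ (by omega)
  have hLr : (L : ℝ) = 4 * d * D := by exact_mod_cast hL
  have hρr : (ρ : ℝ) = 12 * D := by exact_mod_cast hρ
  rw [hLr] at h1
  rw [hρr] at h4
  generalize μ.real (evenReach M U (t - A) \ oddReach M U (t + A)) = b at *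
  generalize μ.real (E ∪ O) = X at *
  generalize μ.real (O \ E) = T at *
  generalize μ.real (E \ O) = H at *
  generalize μ.real (evenReach M U (t + A + 1)) = e₂ at *
  generalize μ.real (evenReach M U (t - A)) = e₁ at *
  generalize μ.real (oddReach M U (t + A)) = o₂ at *
  have hlnn : 0 ≤ μ.real ℓ := measureReal_nonneg
  have hUnn : 0 ≤ μ.real U := measureReal_nonneg
  have k1 : 4 * d * D * b ≤ 4 * D * I.toReal + X := by
    have : (d : ℝ) * (4 * d * D * b) ≤ d * (4 * D * I.toReal + X) := by linarith
    exact le_of_mul_le_mul_left this (by linarith)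
  have k2 : (4 * D : ℝ) * (I.toReal + μ.real ℓ) ≤ 4 * D * (d * T + 2 * μ.real JX) :=
    mul_le_mul_of_nonneg_left h2 (by linarith)
  have k3 : (d * D : ℝ) * μ.real U ≥ D * μ.real U := by
    nlinarith [mul_nonneg (show (0 : ℝ) ≤ D by linarith) hUnn]
  have k4 : 4 * d * D * (e₂ - e₁) ≥ 4 * d * D * (μ.real U + T - b) :=
    mul_le_mul_of_nonneg_left (by linarith) (by positivity)
  -- By `k1` to `k4`, the right side is at least `4D(U + ℓ) - 8D·JX - X`. By `h3`, `4D(U + JX + ℓ) ≥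
  -- 4X`, and by `h4`, `12D·JX ≤ X`, which leaves `4X - X - X`. The values of `L` and `ρ` are chosen
  -- for these two losses of `X`.
  have k5 : 2 * X ≤ 4 * d * D * (e₂ - e₁) := by nlinarith
  have k6 : e₂ - e₁ ≥ 1 / (2 * d * D) * X := by
    rw [ge_iff_le, div_mul_eq_mul_div, div_le_iff₀ (by positivity)]
    linarith
  have k7 : 1 / (2 * d * D) * e₁ ≤ 1 / (2 * d * D) * X :=
    mul_le_mul_of_nonneg_left h9 (by positivity)
  linarith

end Main

/-- With `c` defined by the `Q`-th root, Bernoulli's inequality gives `Q * c ≤ κ`, so `c ≤ 1 / 4`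
and `(1 + κ) * c ≤ 1`. The last bound absorbs the rounding of `n₀ / Q`. -/
theorem exists_rate {κ : ℝ} (hκ : 0 < κ) (hκ' : κ ≤ 1 / 4) {Q : ℕ} (hQ : 1 ≤ Q) :
    ∃ c : ℝ, 0 < c ∧ (1 + c) ^ Q = 1 + κ ∧ (1 + κ) ≤ 1 / c := by
  have hQ0 : (Q : ℝ) ≠ 0 := by positivity
  have hc : 0 < (1 + κ) ^ (1 / (Q : ℝ)) - 1 := by
    rw [sub_pos]
    exact Real.one_lt_rpow (by linarith) (by positivity)
  have hpow : (1 + ((1 + κ) ^ (1 / (Q : ℝ)) - 1)) ^ Q = 1 + κ := by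
    rw [add_sub_cancel, ← Real.rpow_natCast, ← Real.rpow_mul (by linarith), one_div,
      inv_mul_cancel₀ hQ0, Real.rpow_one]
  refine ⟨_, hc, hpow, ?_⟩
  generalize (1 + κ) ^ (1 / (Q : ℝ)) - 1 = c at *
  have h1 := one_add_mul_le_pow (by linarith : (-2 : ℝ) ≤ c) Q
  have h2 : c ≤ Q * c := le_mul_of_one_le_left hc.le (by exact_mod_cast hQ)
  rw [le_div_iff₀ hc]
  nlinarith

end Graphing

theorem mainTheorem5 (d : ℕ) (hd : 2 ≤ d) (r' : ℕ) :
    ∃ (c : ℝ) (r₂ : ℕ), 0 < c ∧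
      ∀ (V : Type u) [MeasurableSpace V] [StandardBorelSpace V]
        (μ : Measure V) [IsProbabilityMeasure μ] (G : SimpleGraph V),
        Graphing.IsGraphing G μ →
        (∀ x, Graphing.deg G x ≤ (d : ℕ∞) + 1) →
        Graphing.AllComponentsInfinite G →
        ∀ J : Set V, J = {x | Graphing.deg G x = (d : ℕ∞) + 1} →
        Graphing.IsSparse G r₂ J →
        ∀ K : Set V, MeasurableSet K → Graphing.IsDense G r' K →
        ∀ M : G.Subgraph, Graphing.IsBorelMatching M →
        ∀ e : V → V, Graphing.IsExclusion d M K e →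
        ∀ n₀ : ℕ,
        (∀ (u v : V) (p : G.Walk u v), p.length ≤ n₀ →
          ¬ Graphing.IsAugmentingPath d M K e p) →
        (∀ x ∈ Graphing.unhappy d M K e, ∀ j ∈ J, (r₂ : ℕ∞) < 4 * G.edist x j) →
        (Graphing.NoOddCycles G ∨ Graphing.NoStumps G d) →
        MeasurableSet (Graphing.unhappy d M K e) ∧
          μ.real (Graphing.unhappy d M K e) ≤ (1 + c) ^ (-(n₀ : ℤ)) / c := by
  obtain ⟨D, hD⟩ : ∃ D, D = (d + 2) ^ (r' + 1) := ⟨_, rfl⟩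
  obtain ⟨L, hL⟩ : ∃ L, L = 4 * d * D := ⟨_, rfl⟩
  obtain ⟨ρ, hρ⟩ : ∃ ρ, ρ = 12 * D := ⟨_, rfl⟩
  obtain ⟨A, hA⟩ : ∃ A, A = L * L + (L * L + L) := ⟨_, rfl⟩
  obtain ⟨κ, hκ⟩ : ∃ κ : ℝ, κ = 1 / (2 * d * D) := ⟨_, rfl⟩
  have hd' : (2 : ℝ) ≤ d := by exact_mod_cast hd
  have hD' : (1 : ℝ) ≤ D := by exact_mod_cast hD ▸ Nat.one_le_pow _ _ (by omega)
  have hκ0 : 0 < κ := by rw [hκ]; positivity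
  have hκ1 : κ ≤ 1 / 4 := by
    rw [hκ]
    exact one_div_le_one_div_of_le (by norm_num) (by nlinarith)
  -- One round of growth takes `2 * A + 1` double steps, that is, `2 * (2 * A + 1)` edges.
  obtain ⟨c, hc, hcQ, hcκ⟩ := Graphing.exists_rate hκ0 hκ1 (Q := 2 * (2 * A + 1)) (by omega)
  -- The first term keeps two vertices of `J` out of one blossom; the second keeps the `ρ`-balls
  -- around `J` disjoint and `U` farther than `ρ` from `J`.
  refine ⟨c, 4 * (L * L) + 4 * ρ, hc, ?_⟩
  rintro V _ _ μ _ G hG hdeg hinf J rfl hJ K mK hK M hM e he n₀ hn₀ hfar hGS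
  obtain ⟨p, hp⟩ := hG.exists_isCover
  have mU := hp.measurableSet_unhappy hG.measurableSet_adj hM (d := d) mK he.measurable
  refine ⟨mU, ?_⟩
  set U := Graphing.unhappy d M K e with hUdef
  have hsparse : ∀ r ≤ 4 * (L * L) + 4 * ρ,
      Graphing.IsSparse G r {x | Graphing.deg G x = (d : ℕ∞) + 1} := fun r hr x hx y hy hxy =>
    lt_of_le_of_lt (by exact_mod_cast hr) (hJ x hx y hy hxy)
  have hfar' : ∀ u ∈ U, ∀ j ∈ {x | Graphing.deg G x = (d : ℕ∞) + 1},
      (ρ : ℕ∞) < G.edist u j := by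
    intro u hu j hj
    by_contra! h
    refine (hfar u hu j hj).not_ge ?_
    calc 4 * G.edist u j ≤ 4 * (ρ : ℕ∞) := by gcongr
      _ ≤ ((4 * (L * L) + 4 * ρ : ℕ) : ℕ∞) := by exact_mod_cast (by omega)
  -- The bound is `N + 1` because the last round uses odd reachability only up to `N`, while its
  -- conclusion concerns one further double step.
  have hiter : ∀ k N : ℕ, 2 * N + 1 ≤ n₀ → (2 * A + 1) * k ≤ N + 1 →
      (1 + κ) ^ k * μ.real U ≤ μ.real (Graphing.evenReach M U ((2 * A + 1) * k)) := by
    intro k N hN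
    have hNodd := Graphing.noOddAugmenting_of_noAugmenting hM.isMatching hn₀ hN
    induction k with
    | zero =>
      intro _
      simpa using measureReal_mono (μ := μ) (Graphing.subset_evenReach (M := M) (U := U) 0)
    | succ k ih =>
      intro hk
      have h0 : (2 * A + 1) * (k + 1) = (2 * A + 1) * k + 2 * A + 1 := by ring
      have h1 := hp.measure_evenReach_growth hG.measurableSet_adj hM.measurableSet_adj mU hNodd
        (by omega) hD hL hρ hA (t := (2 * A + 1) * k + A) (by omega) (by omega) hdeg hinf
        (hsparse _ (by omega)) (hsparse _ (by omega)) hfar' hGS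
        (fun x hx => Graphing.evenReach_of_noAugmenting hM.isMatching hn₀ hN hx) hK
      rw [← hκ, Nat.add_sub_cancel, show (2 * A + 1) * k + A + A + 1 = (2 * A + 1) * (k + 1) by
        ring] at h1
      refine le_trans ?_ h1
      rw [pow_succ', mul_assoc]
      exact mul_le_mul_of_nonneg_left (ih (by omega)) (by linarith)
  have hQ : (1 + κ) ^ (n₀ / (2 * (2 * A + 1))) * μ.real U ≤ 1 := by
    rcases Nat.eq_zero_or_pos n₀ with rfl | hpos
    · simp
    · refine (hiter _ ((n₀ - 1) / 2) (by omega) ?_).trans measureReal_le_one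
      have := Nat.mul_div_le n₀ (2 * (2 * A + 1))
      rw [mul_assoc] at this
      omega
  rw [← hcQ, ← pow_mul] at hQ
  rw [zpow_neg, zpow_natCast, div_eq_mul_inv, ← one_div c, ← div_eq_inv_mul,
    le_div_iff₀ (by positivity)]
  -- Rounding `n₀` up to a multiple of `Q` costs at most one factor `(1 + c) ^ Q = 1 + κ`.
  calc μ.real U * (1 + c) ^ n₀
      ≤ μ.real U * ((1 + c) ^ (2 * (2 * A + 1) * (n₀ / (2 * (2 * A + 1)))) *
        (1 + c) ^ (2 * (2 * A + 1))) := by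
        refine mul_le_mul_of_nonneg_left ?_ measureReal_nonneg
        rw [← pow_add]
        refine pow_le_pow_right₀ (by linarith) ?_
        have := Nat.lt_mul_div_succ n₀ (show 0 < 2 * (2 * A + 1) by omega)
        rw [mul_add, mul_one] at this
        exact this.le
    _ = ((1 + c) ^ (2 * (2 * A + 1) * (n₀ / (2 * (2 * A + 1)))) * μ.real U) * (1 + κ) := by
        rw [hcQ]; ring
    _ ≤ 1 * (1 + κ) := mul_le_mul_of_nonneg_right hQ (by linarith)
    _ ≤ 1 / c := by rw [one_mul]; exact hcκ
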